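/- Let $\{0,1\}^{*}$ and $\{0,1\}^{\omega}$ be the sets of finite and of right-infinite binary words. The Basilica group $B$ is the group of transformations of finite and infinite binary words generated by $a$ and $b$, where $$a(0w)=0\,b(w),\quad a(1w)=1w,\quad b(0w)=1\,a(w),\quad b(1w)=0w .$$ All graphs are undirected, unlabelled multigraphs (loops and parallel edges are kept). For $n\ge 1$, the Schreier graph $\Gamma_n$ has vertex set $\{0,1\}^n$ and, for every vertex $v$ and every $s\in\{a,b\}$, one edge joining $v$ to $s(v)$. For $\xi\in\{0,1\}^{\omega}$, the orbital Schreier graph $\Gamma_\xi$ has vertex set the orbit $B\cdot\xi$ and, for every vertex $\eta$ and every $s\in\{a,b\}$, one edge joining $\eta$ to $s(\eta)$. A ray in a graph is an infinite sequence of distinct vertices, consecutive ones being adjacent; two rays are equivalent if for every finite set $S$ of vertices both have a tail in the same connected component of the graph minus $S$; an end is an equivalence class of rays. Let $E_4$ be the set of all $\xi\in\{0,1\}^{\omega}$ such that $\Gamma_\xi$ has exactly four ends. For $k\ge 1$ let $\mathcal D_k$ be the subgraph of $\Gamma_k$ induced by the vertex $0^k$ and all vertices that cannot be joined to $0^{k-1}1$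 by a path avoiding $0^k$ (for $k=1$ this is a single vertex with a loop). The vertex $0^k$ is the unique vertex of degree $2$ of $\mathcal D_k$. A $k$-decoration is a graph isomorphic to $\mathcal D_k$. The graph $\Gamma_{(4)}$ is constructed as follows. Take two copies $\mathcal R_1$, $\mathcal R_2$ of the double ray with vertex set $\mathbb Z$ (with an edge between $n$ and $n+1$ for every $n$), and let them intersect in the vertex $0$. For $k\ge 0$ let $A_k=\{n\in\mathbb Z: n\equiv 2^k \bmod 2^{k+1}\}$. For every $k\ge 0$, attach to each vertex of $A_k$ in $\mathcal R_1$ a $(2k+1)$-decoration, and to each vertex of $A_k$ in $\mathcal R_2$ a $(2k+2)$-decoration, identifying the vertex with the unique vertex of degree $2$ of the decoration. **Theorem.** The graph $\Gamma_{(4)}$ has exactly four ends, and for every $\xi\in E_4$ the graphs $\Gamma_\xi$ and $\Gamma_{(4)}$ are isomorphic (as unrooted graphs). -/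

import Mathlib

namespace Basilica

open Filter

/-! ### Multigraphs (loops and parallel edges allowed) -/

/-- The multigraph with vertex set `V` and edge set `E` in which the edge `e` has the unordered pair
of ends `ends e`. -/
def graphOfEnds {α β : Type*} (V : Set α) (E : Set β) (ends : β → Sym2 α)
    (h : ∀ e ∈ E, ∀ x ∈ ends e, x ∈ V) : Graph α β where
  vertexSet := V
  edgeSet := E
  IsLink e x y := e ∈ E ∧ ends e = s(x, y)
  isLink_symm e _ := ⟨fun x y hxy => ⟨hxy.1, hxy.2.trans Sym2.eq_swap⟩⟩
  eq_or_eq_of_isLink_of_isLink := by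
    rintro e x y v w ⟨_, h1⟩ ⟨_, h2⟩
    rcases Sym2.eq_iff.1 (h1.symm.trans h2) with h | h
    · exact Or.inl h.1
    · exact Or.inr h.1
  edge_mem_iff_exists_isLink e := by
    constructor
    · intro he
      induction hs : ends e with
      | h x y => exact ⟨x, y, he, rfl⟩
    · rintro ⟨x, y, he, _⟩
      exact he
  left_mem_of_isLink := by
    rintro e x y ⟨he, hs⟩
    exact h e he x (hs ▸ Sym2.mem_mk_left x y)

/-- An isomorphism of (unrooted, unlabelled) multigraphs: a bijection of the vertices together with
a bijection of the edges, compatible with the ends of the edges. -/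
structure GraphIso {α β α' β' : Type*} (G : Graph α β) (H : Graph α' β') where
  onVertices : G.vertexSet ≃ H.vertexSet
  onEdges : G.edgeSet ≃ H.edgeSet
  isLink_iff : ∀ (e : G.edgeSet) (x y : G.vertexSet),
    G.IsLink e x y ↔ H.IsLink (onEdges e) (onVertices x) (onVertices y)

/-! ### Ends -/

/-- A ray: an infinite sequence of distinct vertices, consecutive ones being adjacent. -/
structure Ray {α β : Type*} (G : Graph α β) where
  toFun : ℕ → G.vertexSet
  injective : Function.Injective toFun
  adj : ∀ n, G.Adj (toFun n) (toFun (n + 1))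

/-- Two rays are equivalent if for every finite set `S` of vertices both have a tail in the same
connected component of the graph minus `S`. -/
def RayEquiv {α β : Type*} {G : Graph α β} (r r' : Ray G) : Prop :=
  ∀ S : Set G.vertexSet, S.Finite → ∃ C : G.toSimpleGraph.ComponentCompl S,
    (∀ᶠ n in atTop, r.toFun n ∈ C) ∧ (∀ᶠ n in atTop, r'.toFun n ∈ C)

theorem rayEquiv_refl {α β : Type*} {G : Graph α β} (r : Ray G) : RayEquiv r r := by
  intro S hS
  have h1 : ∀ᶠ n in atTop, r.toFun n ∉ S := by
    have := r.injective.tendsto_cofinite hS.compl_mem_cofinite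
    rw [Nat.cofinite_eq_atTop] at this
    exact this
  obtain ⟨N, hN⟩ := eventually_atTop.1 h1
  have h2 : ∀ n ≥ N, r.toFun n ∈ G.toSimpleGraph.componentComplMk (hN N le_rfl) := by
    intro n hn
    induction n, hn using Nat.le_induction with
    | base => exact SimpleGraph.componentComplMk_mem _ _
    | succ n hn ih =>
      refine SimpleGraph.ComponentCompl.mem_of_adj _ _ ih (hN _ (by omega)) ⟨?_, r.adj n⟩
      intro h
      have := r.injective h
      omega
  exact ⟨_, eventually_atTop.2 ⟨N, h2⟩, eventually_atTop.2 ⟨N, h2⟩⟩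

theorem rayEquiv_symm {α β : Type*} {G : Graph α β} {r r' : Ray G} (h : RayEquiv r r') :
    RayEquiv r' r := fun S hS =>
  let ⟨C, h1, h2⟩ := h S hS
  ⟨C, h2, h1⟩

theorem rayEquiv_trans {α β : Type*} {G : Graph α β} {r r' r'' : Ray G} (h : RayEquiv r r')
    (h' : RayEquiv r' r'') : RayEquiv r r'' := by
  intro S hS
  obtain ⟨C, h1, h2⟩ := h S hS
  obtain ⟨D, h3, h4⟩ := h' S hS
  obtain ⟨n, hnC, hnD⟩ := (h2.and h3).exists
  obtain ⟨_, rfl⟩ := hnC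
  obtain ⟨_, rfl⟩ := hnD
  exact ⟨_, h1, h4⟩

instance raySetoid {α β : Type*} (G : Graph α β) : Setoid (Ray G) :=
  ⟨RayEquiv, rayEquiv_refl, rayEquiv_symm, rayEquiv_trans⟩

/-- The ends of a graph: the equivalence classes of rays. -/
def GraphEnd {α β : Type*} (G : Graph α β) : Type _ := Quotient (raySetoid G)

/-- `G` has exactly `k` ends. -/
def HasEnds {α β : Type*} (G : Graph α β) (k : ℕ) : Prop := ENat.card (GraphEnd G) = k

/-! ### The Basilica group -/

/-- The states of the automaton generating the Basilica group. -/
inductive State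
  | a
  | b
  | idle

namespace State

/-- The transition map. The letter `0` is `false`, the letter `1` is `true`. -/
def next : State → Bool → State
  | a, false => b
  | b, false => a
  | _, _ => idle

/-- The output map. -/
def out : State → Bool → Bool
  | b, x => !x
  | _, x => x

theorem out_out (s : State) (x : Bool) : s.out (s.out x) = x := by
  cases s <;> cases x <;> rfl

/-- The action of a state on finite words. -/
def onWord : State → List Bool → List Bool
  | _, [] => []
  | s, x :: w => s.out x :: (s.next x).onWord w

/-- The state reached from `s` after reading the first `n` letters of the infinite word `ξ`. -/
def run (s : State) (ξ : ℕ → Bool) : ℕ → State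
  | 0 => s
  | n + 1 => (run s ξ n).next (ξ n)

/-- The action of a state on infinite words. -/
def onSeq (s : State) (ξ : ℕ → Bool) : ℕ → Bool := fun n => (s.run ξ n).out (ξ n)

/-- The inverse of `onWord`. -/
def invWord : State → List Bool → List Bool
  | _, [] => []
  | s, y :: w => s.out y :: (s.next (s.out y)).invWord w

/-- The state reached by the automaton after it has written the first `n` letters of `η`. -/
def invRun (s : State) (η : ℕ → Bool) : ℕ → State
  | 0 => s
  | n + 1 => (invRun s η n).next ((invRun s η n).out (η n))

/-- The inverse of `onSeq`. -/
def invSeq (s : State) (η : ℕ → Bool) : ℕ → Bool := fun n => (s.invRun η n).out (η n)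

theorem invWord_onWord (s : State) (w : List Bool) : s.invWord (s.onWord w) = w := by
  induction w generalizing s with
  | nil => rfl
  | cons x w ih => simp [onWord, invWord, out_out, ih]

theorem onWord_invWord (s : State) (w : List Bool) : s.onWord (s.invWord w) = w := by
  induction w generalizing s with
  | nil => rfl
  | cons x w ih => simp [onWord, invWord, out_out, ih]

theorem invRun_onSeq (s : State) (ξ : ℕ → Bool) (n : ℕ) : s.invRun (s.onSeq ξ) n = s.run ξ n := by
  induction n with
  | zero => rfl
  | succ n ih => simp [invRun, run, ih, onSeq, out_out]

theorem run_invSeq (s : State) (η : ℕ → Bool) (n : ℕ) : s.run (s.invSeq η) n = s.invRun η n := by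
  induction n with
  | zero => rfl
  | succ n ih => simp [invRun, run, ih, invSeq]

/-- The permutation of the finite words defined by a state. -/
def permWord (s : State) : Equiv.Perm (List Bool) where
  toFun := s.onWord
  invFun := s.invWord
  left_inv := s.invWord_onWord
  right_inv := s.onWord_invWord

/-- The permutation of the infinite words defined by a state. -/
def permSeq (s : State) : Equiv.Perm (ℕ → Bool) where
  toFun := s.onSeq
  invFun := s.invSeq
  left_inv ξ := by
    funext n
    simp [invSeq, invRun_onSeq, onSeq, out_out]
  right_inv η := by
    funext n
    simp [onSeq, run_invSeq, invSeq, out_out]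

/-- The transformation of the set of all finite and infinite words defined by a state. -/
def perm (s : State) : Equiv.Perm (List Bool) × Equiv.Perm (ℕ → Bool) := (s.permWord, s.permSeq)

end State

/-- The Basilica group, generated by the transformations `a` and `b` of the finite and infinite
binary words. -/
def basilica : Subgroup (Equiv.Perm (List Bool) × Equiv.Perm (ℕ → Bool)) :=
  Subgroup.closure {State.a.perm, State.b.perm}

/-- The action of the Basilica group on the finite words, that is, on the binary rooted tree. -/
instance : MulAction basilica (List Bool) :=
  MulAction.compHom (List Bool) ((MonoidHom.fst _ _).comp basilica.subtype)

/-- The action of the Basilica group on the infinite words, that is, on the boundary of the tree. -/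
instance : MulAction basilica (ℕ → Bool) :=
  MulAction.compHom (ℕ → Bool) ((MonoidHom.snd _ _).comp basilica.subtype)

/-- Names for the two generators. -/
inductive Gen
  | a
  | b

/-- The generators `a` and `b` as elements of the Basilica group. -/
def Gen.elt : Gen → basilica
  | .a => ⟨State.a.perm, Subgroup.subset_closure (Set.mem_insert _ _)⟩
  | .b => ⟨State.b.perm, Subgroup.subset_closure (Set.mem_insert_of_mem _ rfl)⟩

/-! ### Schreier graphs -/

/-- The graph of the action of a group `G` on a set `M` with respect to generators `gen i`: there
is one edge for each point `m` and each generator, and it joins `m` to the image of `m`. Edges are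
considered as undirected and unlabelled; loops and parallel edges are kept. -/
def schreierGraph {G M ι : Type*} [Group G] [MulAction G M] (gen : ι → G) : Graph M (M × ι) :=
  graphOfEnds Set.univ Set.univ (fun e => s(e.1, gen e.2 • e.1)) (fun _ _ _ _ => Set.mem_univ _)

/-- The `n`-th Schreier graph of the Basilica group, on the binary words of length `n`. -/
def finiteSchreier (n : ℕ) : Graph (List Bool) (List Bool × Gen) :=
  (schreierGraph Gen.elt).induce {w | w.length = n}

/-- The orbital Schreier graph of the infinite word `ξ`, on the orbit of `ξ`. -/
def orbitalSchreier (ξ : ℕ → Bool) : Graph (ℕ → Bool) ((ℕ → Bool) × Gen) :=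
  (schreierGraph Gen.elt).induce (MulAction.orbit basilica ξ)

/-- The set of infinite words whose orbital Schreier graph has exactly four ends. -/
def E4 : Set (ℕ → Bool) := {ξ | HasEnds (orbitalSchreier ξ) 4}

/-! ### Decorations -/

/-- The word `0 ⋯ 0` of length `k`. -/
def zeros (k : ℕ) : List Bool := List.replicate k false

/-- The word `0 ⋯ 01` of length `k` (for `1 ≤ k`). -/
def zerosOne (k : ℕ) : List Bool := List.replicate (k - 1) false ++ [true]

/-- The decoration of the vertex `0 ⋯ 0` in the `k`-th Schreier graph (for `1 ≤ k`): the subgraph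
induced by this vertex and by all vertices that its removal separates from `0 ⋯ 01`. A
`k`-decoration is a graph isomorphic to this one. (For `k = 1` it is a vertex with a loop.) Its
unique vertex of degree two is `zeros k`. -/
def decoration (k : ℕ) : Graph (List Bool) (List Bool × Gen) :=
  (finiteSchreier k).induce {w ∈ (finiteSchreier k).vertexSet | w = zeros k ∨
    ¬ Relation.ReflTransGen ((finiteSchreier k).deleteVerts {zeros k}).Adj (zerosOne k) w}

/-! ### The graph `Γ_(4)` -/

/-- The set `A_k` of integers congruent to `2 ^ k` modulo `2 ^ (k + 1)`. -/
def A (k : ℕ) : Set ℤ := {n | n ≡ 2 ^ k [ZMOD 2 ^ (k + 1)]}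

/-- The sets `A k` partition the nonzero integers: `A k` consists of those of `2`-adic
valuation `k`. -/
theorem mem_A_iff (k : ℕ) (n : ℤ) : n ∈ A k ↔ n ≠ 0 ∧ padicValInt 2 n = k := by
  have key : n ∈ A k ↔ (2 : ℤ) ^ k ∣ n ∧ ¬ (2 : ℤ) ^ (k + 1) ∣ n := by
    have h0 : n ∈ A k ↔ n ≡ 2 ^ k [ZMOD 2 ^ (k + 1)] := Iff.rfl
    have hpos : (0 : ℤ) < 2 ^ k := by positivity
    rw [h0, Int.modEq_iff_dvd]
    constructor
    · rintro ⟨c, hc⟩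
      have hn : n = 2 ^ k * (1 - 2 * c) := by rw [pow_succ] at hc; linarith
      refine ⟨⟨_, hn⟩, ?_⟩
      rw [hn, pow_succ, mul_dvd_mul_iff_left hpos.ne']
      omega
    · rintro ⟨⟨m, rfl⟩, h⟩
      rw [pow_succ, mul_dvd_mul_iff_left hpos.ne'] at h
      refine ⟨-(m / 2), ?_⟩
      have hm : m = 2 * (m / 2) + 1 := by omega
      rw [pow_succ]
      linear_combination (-(2 : ℤ) ^ k) * hm
  have h1 := padicValInt_dvd_iff (p := 2) k n
  have h2 := padicValInt_dvd_iff (p := 2) (k + 1) n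
  push_cast at h1 h2
  rw [key, h1, h2]
  by_cases hn : n = 0
  · simp [hn]
  · simp only [hn, false_or, ne_eq, not_false_eq_true, true_and]
    omega

/-- The two double rays. -/
inductive Line
  | one
  | two

/-- The height of the decoration attached to the point `n ≠ 0` of a line: if `n ∈ A k`, it is
`2 * k + 1` on the first line and `2 * k + 2` on the second. -/
def height : Line → ℤ → ℕ
  | .one, n => 2 * padicValInt 2 n + 1
  | .two, n => 2 * padicValInt 2 n + 2

theorem height_one {k : ℕ} {n : ℤ} (h : n ∈ A k) : height .one n = 2 * k + 1 := by
  rw [height, ((mem_A_iff k n).1 h).2]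

theorem height_two {k : ℕ} {n : ℤ} (h : n ∈ A k) : height .two n = 2 * k + 2 := by
  rw [height, ((mem_A_iff k n).1 h).2]

/-- Vertices of `Γ_(4)`: the common point `0` of the two lines, and the vertices `w` of the
decoration attached at the point `n ≠ 0` of a line. -/
inductive Vertex4
  | origin
  | deco (i : Line) (n : ℤ) (w : List Bool)

/-- The point `n` of the line `i`. For `n ≠ 0` it is identified with the vertex `0 ⋯ 0` of degree
two of the decoration attached there. -/
def linePoint (i : Line) (n : ℤ) : Vertex4 :=
  if n = 0 then .origin else .deco i n (zeros (height i n))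

/-- Edges of `Γ_(4)`: for every integer `n` the edge from `n` to `n + 1` of the line `i`, and the
edges of the decoration attached at the point `n ≠ 0` of a line. -/
inductive Edge4
  | line (i : Line) (n : ℤ)
  | deco (i : Line) (n : ℤ) (e : List Bool × Gen)

/-- The vertex set of `Γ_(4)`. -/
def vertices4 : Set Vertex4 :=
  {v | match v with
    | .origin => True
    | .deco i n w => n ≠ 0 ∧ w ∈ (decoration (height i n)).vertexSet}

/-- The edge set of `Γ_(4)`. -/
def edges4 : Set Edge4 :=
  {e | match e with
    | .line _ _ => True
    | .deco i n e => n ≠ 0 ∧ e ∈ (decoration (height i n)).edgeSet}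

/-- The ends of the edges of `Γ_(4)`. -/
def ends4 : Edge4 → Sym2 Vertex4
  | .line i n => s(linePoint i n, linePoint i (n + 1))
  | .deco i n e => s(.deco i n e.1, .deco i n (e.2.elt • e.1))

theorem linePoint_mem (i : Line) (n : ℤ) : linePoint i n ∈ vertices4 := by
  by_cases hn : n = 0
  · simp [linePoint, hn, vertices4]
  · simp [linePoint, hn, vertices4, decoration, finiteSchreier, zeros]

theorem mem_vertices4_of_mem_ends4 : ∀ e ∈ edges4, ∀ x ∈ ends4 e, x ∈ vertices4 := by
  intro e he x hx
  cases e with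
  | line i n =>
    rcases Sym2.mem_iff.1 hx with rfl | rfl
    · exact linePoint_mem i n
    · exact linePoint_mem i (n + 1)
  | deco i n e =>
    obtain ⟨hn, he⟩ := he
    obtain ⟨u, v, huv⟩ := Graph.exists_isLink_of_mem_edgeSet he
    have hends : s(e.1, e.2.elt • e.1) = s(u, v) := huv.1.1.2
    rcases Sym2.mem_iff.1 hx with rfl | rfl
    · refine ⟨hn, ?_⟩
      rcases Sym2.eq_iff.1 hends with ⟨h, _⟩ | ⟨h, _⟩ <;> rw [h]
      exacts [huv.left_mem, huv.right_mem]
    · refine ⟨hn, ?_⟩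
      rcases Sym2.eq_iff.1 hends with ⟨_, h⟩ | ⟨_, h⟩ <;> rw [h]
      exacts [huv.right_mem, huv.left_mem]

/-- The graph `Γ_(4)`: two double rays crossing at `0`, with a `(2k+1)`-decoration attached to each
point of `A k` on the first one and a `(2k+2)`-decoration to each point of `A k` on the second. -/
def Gamma4 : Graph Vertex4 Edge4 := graphOfEnds vertices4 edges4 ends4 mem_vertices4_of_mem_ends4

end Basilica

/-!
The vertex `0 ⋯ 0` cuts the `k`-th Schreier graph into components, and the position of the last
letter `1` of a word knows which one contains it: along an edge that avoids `0 ⋯ 0` the parity of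
this position does not change (`lastOne_eq_of_reflTransGen`), and words with the same parity are
connected (`reflTransGen_of_lastOne_eq`). So the `k`-decoration consists of `0 ⋯ 0` and of the words
whose last `1` stands at a position of the parity of `k` (`mem_decoration_iff`). In particular its
words end in `0`, and its root is the only vertex from which a generator leaves it.

The two lines of `Γ_(4)` are the orbits of `000⋯` under `b` and `a`. By `a(0w) = 0b(w)` and
`b²(0w) = 0a(w)`, the point `n ≠ 0` of a line is `0 ⋯ 01⋯`, where the number of zeros is one less
than the height of the decoration attached there (`exists_linePt_eq`). Replacing the final `0` of
the words of this decoration by the tail `1⋯` of that point commutes with the generators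
(`smul_point`), because a state that fixes the letter `0` also fixes every tail beginning with `1`.
The resulting map from the vertices of `Γ_(4)` to infinite words is injective
(`point_injOn`), since an infinite word determines where the tail begins, and its image is the orbit
of `000⋯` (`exists_point_eq`). This gives an isomorphism of `Γ_(4)` with the orbital Schreier graph
of `000⋯` (`nonempty_iso_zeroSeq`).

A connected graph exhausted by finite sets with at most `m` outer neighbours has at most `m` ends
(`card_graphEnd_le_of_boundary`). Intervals of the two lines with their decorations have four outer
neighbours, and the origin separates the four half-lines, so `Γ_(4)` has four ends
(`hasEnds_Gamma4`). If `ξ` is not in the orbit of `000⋯`, its orbit consists of words cofinal with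
`ξ`, and `ξ` has infinitely many letters `1`. The words that agree with `ξ` from the position `n`
on have at most two outer neighbours if `1` stands there (`exists_boundary`): an edge leaves this
set only if it starts or ends in a word beginning with `n` zeros, and the automaton in the state `a`
does not change a tail beginning with `1`. So the orbital Schreier graph of `ξ` has at most two
ends, and the words with four ends form the orbit of `000⋯`.
-/

namespace Basilica

open Filter

/-! ### Counting ends -/

section Ends

variable {α β : Type*} {G : Graph α β}

/-- A ray leaves every finite set of vertices and then stays in a single component. -/
theorem Ray.exists_componentCompl (r : Ray G) {S : Set G.vertexSet} (hS : S.Finite) :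
    ∃ C : G.toSimpleGraph.ComponentCompl S, ∀ᶠ n in atTop, r.toFun n ∈ C :=
  let ⟨C, h, _⟩ := rayEquiv_refl r S hS
  ⟨C, h⟩

/-- If a connected graph is exhausted by finite sets `S` of vertices each of which has at most `m`
outer neighbours, then among any `m + 1` rays two are equivalent: every component of the complement
of `S` contains an outer neighbour of `S`, so there are at most `m` components. -/
theorem exists_rayEquiv_of_boundary {m : ℕ} (hG : G.toSimpleGraph.Preconnected)
    (hne : G.vertexSet.Nonempty)
    (hS : ∀ T : Set G.vertexSet, T.Finite → ∃ S : Set G.vertexSet, S.Finite ∧ T ⊆ S ∧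
      ∃ B : Finset α, B.card ≤ m ∧
        ∀ u ∈ S, ∀ v ∉ S, G.toSimpleGraph.Adj v u → (v : α) ∈ B)
    (r : Fin (m + 1) → Ray G) : ∃ i j, i ≠ j ∧ RayEquiv (r i) (r j) := by
  by_contra! hcon
  have hsep : ∀ i j, ∃ S : Set G.vertexSet, S.Finite ∧ (i ≠ j →
      ¬ ∃ C : G.toSimpleGraph.ComponentCompl S,
        (∀ᶠ n in atTop, (r i).toFun n ∈ C) ∧ (∀ᶠ n in atTop, (r j).toFun n ∈ C)) := by
    intro i j
    by_cases hij : i = j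
    · exact ⟨∅, Set.finite_empty, fun h => absurd hij h⟩
    · have := hcon i j hij
      unfold RayEquiv at this
      obtain ⟨S, hS⟩ := not_forall.1 this
      obtain ⟨hf, hs⟩ := Classical.not_imp.1 hS
      exact ⟨S, hf, fun _ => hs⟩
  choose T hTf hT using hsep
  obtain ⟨v₀, hv₀⟩ := hne
  obtain ⟨S, hSf, hTS, B, hB, hb⟩ := hS ({⟨v₀, hv₀⟩} ∪ ⋃ i, ⋃ j, T i j)
    ((Set.finite_singleton _).union
      (Set.finite_iUnion fun i => Set.finite_iUnion fun j => hTf i j))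
  choose C hC using fun i => (r i).exists_componentCompl hSf
  have hne' : S.Nonempty := ⟨_, hTS (Or.inl rfl)⟩
  have hCB : ∀ i, ∃ b : G.vertexSet, (b : α) ∈ B ∧ b ∈ C i := by
    intro i
    obtain ⟨⟨c, k⟩, h1, h2, h3⟩ := (C i).exists_adj_boundary_pair hG hne'
    exact ⟨c, hb k h2 c ((C i).notMem_of_mem h1) h3, h1⟩
  choose b hbB hbC using hCB
  obtain ⟨i, -, j, -, hij, hbij⟩ := Finset.exists_ne_map_eq_of_card_lt_of_maps_to
    (s := Finset.univ) (t := B) (by simpa using Nat.lt_succ_of_le hB)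
    (f := fun i => (b i : α)) (fun i _ => hbB i)
  have hCij : C i = C j := by
    by_contra hne
    exact (Set.disjoint_left.1 (SimpleGraph.ComponentCompl.pairwise_disjoint hne))
      (hbC i) (Subtype.ext hbij ▸ hbC j)
  have hsub : T i j ⊆ S := fun x hx =>
    hTS (Or.inr (Set.mem_iUnion.2 ⟨i, Set.mem_iUnion.2 ⟨j, hx⟩⟩))
  refine hT i j hij ⟨(C i).hom hsub, ?_, ?_⟩
  · exact (hC i).mono fun n hn => (C i).subset_hom hsub hn
  · exact (hC j).mono fun n hn => hCij ▸ (C j).subset_hom hsub hn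

theorem card_graphEnd_le_of_boundary {m : ℕ} (hG : G.toSimpleGraph.Preconnected)
    (hne : G.vertexSet.Nonempty)
    (hS : ∀ T : Set G.vertexSet, T.Finite → ∃ S : Set G.vertexSet, S.Finite ∧ T ⊆ S ∧
      ∃ B : Finset α, B.card ≤ m ∧
        ∀ u ∈ S, ∀ v ∉ S, G.toSimpleGraph.Adj v u → (v : α) ∈ B) :
    ENat.card (GraphEnd G) ≤ m := by
  by_contra! hlt
  have h1 : ENat.card (Fin (m + 1)) ≤ ENat.card (GraphEnd G) := by
    simpa using Order.add_one_le_of_lt hlt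
  have h2 : Nonempty (Fin (m + 1) ↪ GraphEnd G) := by
    rw [← Cardinal.lift_mk_le']
    have h3 : ((m + 1 : ℕ) : Cardinal) ≤ Cardinal.mk (GraphEnd G) := by
      rw [← Cardinal.natCast_le_toENat]
      simpa [ENat.card] using h1
    simpa using h3
  obtain ⟨f⟩ := h2
  obtain ⟨i, j, hij, h⟩ := exists_rayEquiv_of_boundary hG hne hS fun i => (f i).out
  refine hij (f.injective ?_)
  rw [← (f i).out_eq, ← (f j).out_eq]
  exact Quotient.sound h

end Ends

/-- Maps of vertices and edges that are bijective and preserve incidence form an isomorphism. -/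
theorem GraphIso.nonempty_of_bijective {α β α' β' : Type*} {G : Graph α β} {H : Graph α' β'}
    (f : G.vertexSet → H.vertexSet) (g : G.edgeSet → H.edgeSet) (hf : Function.Bijective f)
    (hg : Function.Bijective g)
    (h : ∀ (e : G.edgeSet) (x y : G.vertexSet), G.IsLink e x y → H.IsLink (g e) (f x) (f y)) :
    Nonempty (GraphIso G H) := by
  refine ⟨⟨Equiv.ofBijective f hf, Equiv.ofBijective g hg, fun e x y => ⟨h e x y, fun h' => ?_⟩⟩⟩
  obtain ⟨u, v, huv⟩ := Graph.exists_isLink_of_mem_edgeSet e.2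
  have h1 := h e ⟨u, huv.left_mem⟩ ⟨v, huv.right_mem⟩ huv
  rcases h1.eq_and_eq_or_eq_and_eq h' with ⟨h2, h3⟩ | ⟨h2, h3⟩
  · have h2 := hf.1 (Subtype.ext h2)
    have h3 := hf.1 (Subtype.ext h3)
    subst h2 h3
    exact huv
  · have h2 := hf.1 (Subtype.ext h2)
    have h3 := hf.1 (Subtype.ext h3)
    subst h2 h3
    exact huv.symm

theorem GraphIso.nonempty_symm {α β α' β' : Type*} {G : Graph α β} {H : Graph α' β'}
    (h : Nonempty (GraphIso G H)) : Nonempty (GraphIso H G) := by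
  obtain ⟨f, g, h⟩ := h
  refine ⟨⟨f.symm, g.symm, fun e x y => ?_⟩⟩
  simpa using (h (g.symm e) (f.symm x) (f.symm y)).symm

/-- Preconnectedness of the underlying simple graph is invariant under isomorphism. -/
theorem GraphIso.preconnected {α β α' β' : Type*} {G : Graph α β} {H : Graph α' β'}
    (φ : GraphIso G H) (hG : G.toSimpleGraph.Preconnected) : H.toSimpleGraph.Preconnected := by
  have hhom : ∀ x y, G.toSimpleGraph.Adj x y →
      H.toSimpleGraph.Adj (φ.onVertices x) (φ.onVertices y) := by
    rintro x y ⟨hne, e, he⟩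
    exact ⟨fun h => hne (φ.onVertices.injective h),
      _, (φ.isLink_iff ⟨e, he.edge_mem⟩ x y).1 he⟩
  let F : G.toSimpleGraph →g H.toSimpleGraph := ⟨φ.onVertices, fun h => hhom _ _ h⟩
  exact hG.map F φ.onVertices.surjective

/-! ### Orbits of the Basilica group -/

section Orbits

variable {X : Type*} [MulAction basilica X]

theorem closure_range_elt : Subgroup.closure (Set.range Gen.elt) = ⊤ := by
  have h : Set.range Gen.elt = ((↑) : basilica → _) ⁻¹' {State.a.perm, State.b.perm} := by
    ext g
    simp only [Set.mem_range, Set.mem_preimage, Set.mem_insert_iff, Set.mem_singleton_iff]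
    constructor
    · rintro ⟨_ | _, rfl⟩
      exacts [Or.inl rfl, Or.inr rfl]
    · rintro (h | h)
      exacts [⟨.a, Subtype.ext h.symm⟩, ⟨.b, Subtype.ext h.symm⟩]
  rw [h]
  exact Subgroup.closure_closure_coe_preimage

theorem smul_mem_orbit {x y : X} (g : basilica) (h : y ∈ MulAction.orbit basilica x) :
    g • y ∈ MulAction.orbit basilica x := by
  obtain ⟨k, rfl⟩ := h
  exact ⟨g * k, mul_smul g k x⟩

/-- To prove a property of the points of an orbit, it is enough to propagate it along the generators
and their inverses. -/
theorem orbit_induction {x : X} {P : X → Prop} (h0 : P x)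
    (h1 : ∀ y ∈ MulAction.orbit basilica x, P y → ∀ s : Gen, P (s.elt • y))
    (h2 : ∀ y ∈ MulAction.orbit basilica x, P y → ∀ s : Gen, P (s.elt⁻¹ • y)) :
    ∀ y ∈ MulAction.orbit basilica x, P y := by
  rintro _ ⟨g, rfl⟩
  have hg : g ∈ Subgroup.closure (Set.range Gen.elt) := closure_range_elt ▸ Subgroup.mem_top g
  show P (g • x)
  induction hg using Subgroup.closure_induction_left with
  | one => rwa [one_smul]
  | mul_left s hs g _ ih =>
    obtain ⟨s, rfl⟩ := hs
    rw [mul_smul]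
    exact h1 _ (MulAction.mem_orbit _ _) ih s
  | inv_mul_cancel s hs g _ ih =>
    obtain ⟨s, rfl⟩ := hs
    rw [mul_smul]
    exact h2 _ (MulAction.mem_orbit _ _) ih s

/-- A semiconjugacy between the actions of two group elements is one between their powers. -/
theorem zpow_smul_semiconj {G M : Type*} [Group G] [MulAction G M] {g h : G} {f : M → M}
    (H : ∀ x, g • f x = f (h • x)) (n : ℤ) (x : M) : g ^ n • f x = f (h ^ n • x) := by
  induction n generalizing x with
  | zero => simp
  | succ n ih => rw [zpow_add_one, zpow_add_one, mul_smul, H, ih, mul_smul]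
  | pred n ih =>
    have H' : ∀ x, g⁻¹ • f x = f (h⁻¹ • x) := fun x => by rw [inv_smul_eq_iff, H, smul_inv_smul]
    rw [zpow_sub_one, zpow_sub_one, mul_smul, H', ih, mul_smul]

end Orbits

/-! ### Infinite words with a finite prefix -/

/-- The infinite word `xτ`. -/
def consSeq (x : Bool) (τ : ℕ → Bool) : ℕ → Bool
  | 0 => x
  | n + 1 => τ n

/-- The infinite word `wτ`. -/
def appSeq : List Bool → (ℕ → Bool) → ℕ → Bool
  | [], τ => τ
  | x :: w, τ => consSeq x (appSeq w τ)

/-- The infinite word `000⋯`. -/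
def zeroSeq : ℕ → Bool := fun _ => false

theorem consSeq_inj {x y : Bool} {τ σ : ℕ → Bool} (h : consSeq x τ = consSeq y σ) :
    x = y ∧ τ = σ :=
  ⟨congrFun h 0, funext fun n => congrFun h (n + 1)⟩

theorem consSeq_head_tail (τ : ℕ → Bool) : consSeq (τ 0) (fun n => τ (n + 1)) = τ := by
  funext n
  cases n <;> rfl

theorem consSeq_zeroSeq : consSeq false zeroSeq = zeroSeq := consSeq_head_tail zeroSeq

theorem appSeq_inj {w v : List Bool} {τ σ : ℕ → Bool} (hl : w.length = v.length)
    (h : appSeq w τ = appSeq v σ) : w = v ∧ τ = σ := by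
  induction w generalizing v with
  | nil =>
    obtain rfl := List.length_eq_zero_iff.1 hl.symm
    exact ⟨rfl, h⟩
  | cons x w ih =>
    cases v with
    | nil => simp at hl
    | cons y v =>
      obtain ⟨rfl, h2⟩ := consSeq_inj h
      obtain ⟨rfl, h3⟩ := ih (by simpa using hl) h2
      exact ⟨rfl, h3⟩

theorem appSeq_apply_add (w : List Bool) (τ : ℕ → Bool) (j : ℕ) :
    appSeq w τ (w.length + j) = τ j := by
  induction w with
  | nil => simp [appSeq]
  | cons x w ih =>
    rw [List.length_cons, show w.length + 1 + j = (w.length + j) + 1 by omega]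
    exact ih

theorem appSeq_apply_lt (w : List Bool) (τ : ℕ → Bool) (j : ℕ) (hj : j < w.length) :
    appSeq w τ j = w.getD j false := by
  induction w generalizing j with
  | nil => simp at hj
  | cons x w ih =>
    cases j with
    | zero => rfl
    | succ j =>
      rw [List.getD_cons_succ]
      exact ih j (by simpa using hj)

theorem appSeq_prefix (n : ℕ) (ξ : ℕ → Bool) :
    ∃ w : List Bool, w.length = n ∧ appSeq w (fun j => ξ (n + j)) = ξ := by
  induction n generalizing ξ with
  | zero => exact ⟨[], rfl, by funext j; simp [appSeq]⟩
  | succ n ih =>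
    obtain ⟨w, hw, h⟩ := ih (fun j => ξ (j + 1))
    refine ⟨ξ 0 :: w, by simp [hw], ?_⟩
    rw [appSeq, show (fun j => ξ (n + 1 + j)) = fun j => ξ (n + j + 1) by
      funext j; congr 1; omega, h]
    exact consSeq_head_tail ξ

/-! ### The automaton on prefixes -/

namespace State

/-- The state reached from `s` after reading the word `w`. -/
def after : State → List Bool → State
  | s, [] => s
  | s, x :: w => after (s.next x) w

theorem length_onWord (s : State) (w : List Bool) : (s.onWord w).length = w.length := by
  induction w generalizing s with
  | nil => rfl
  | cons x w ih => simp [onWord, ih]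

theorem onWord_idle (w : List Bool) : idle.onWord w = w := by
  induction w with
  | nil => rfl
  | cons x w ih => exact congrArg (x :: ·) ih

theorem run_idle (τ : ℕ → Bool) (n : ℕ) : idle.run τ n = idle := by
  induction n with
  | zero => rfl
  | succ n ih => simp [run, ih, next]

theorem onSeq_idle (τ : ℕ → Bool) : idle.onSeq τ = τ := by
  funext n
  simp [onSeq, run_idle, out]

theorem run_consSeq (s : State) (x : Bool) (τ : ℕ → Bool) (n : ℕ) :
    s.run (consSeq x τ) (n + 1) = (s.next x).run τ n := by
  induction n with
  | zero => rfl
  | succ n ih => rw [run, ih, run, consSeq]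

theorem onSeq_consSeq (s : State) (x : Bool) (τ : ℕ → Bool) :
    s.onSeq (consSeq x τ) = consSeq (s.out x) ((s.next x).onSeq τ) := by
  funext n
  cases n with
  | zero => rfl
  | succ n => simp only [onSeq, run_consSeq, consSeq]

theorem onSeq_appSeq (s : State) (w : List Bool) (τ : ℕ → Bool) :
    s.onSeq (appSeq w τ) = appSeq (s.onWord w) ((s.after w).onSeq τ) := by
  induction w generalizing s with
  | nil => rfl
  | cons x w ih => rw [appSeq, onSeq_consSeq, ih]; rfl

theorem onWord_append (s : State) (w v : List Bool) :
    s.onWord (w ++ v) = s.onWord w ++ (s.after w).onWord v := by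
  induction w generalizing s with
  | nil => rfl
  | cons x w ih => simp [onWord, ih, after]

theorem after_idle (w : List Bool) : idle.after w = idle := by
  induction w with
  | nil => rfl
  | cons x w ih => exact ih

theorem next_true (s : State) : s.next true = idle := by cases s <;> rfl

/-- The automaton stays active only along a word of zeros. -/
theorem eq_zeros_of_after_ne_idle {s : State} {w : List Bool} (h : s.after w ≠ idle) :
    w = zeros w.length := by
  induction w generalizing s with
  | nil => rfl
  | cons x w ih =>
    cases x with
    | true => rw [after, next_true] at h; exact absurd (after_idle w) h
    | false => exact congrArg (false :: ·) (ih h)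

theorem after_zeros_injective (n : ℕ) : Function.Injective fun s : State => s.after (zeros n) := by
  induction n with
  | zero => exact fun _ _ h => h
  | succ n ih =>
    intro s t h
    have h' : s.next false = t.next false := ih h
    revert h'
    cases s <;> cases t <;> simp [next]

end State

/-- The state of the automaton corresponding to a generator. -/
def Gen.state : Gen → State
  | .a => .a
  | .b => .b

theorem Gen.elt_smul_word (s : Gen) (w : List Bool) : s.elt • w = s.state.onWord w := by
  cases s <;> rfl

theorem Gen.elt_smul_seq (s : Gen) (ξ : ℕ → Bool) : s.elt • ξ = s.state.onSeq ξ := by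
  cases s <;> rfl

theorem Gen.state_injective : Function.Injective Gen.state := by
  intro s t h
  cases s <;> cases t <;> first | rfl | exact absurd h (by simp [Gen.state])

theorem length_smul_word (g : basilica) (w : List Bool) : (g • w).length = w.length := by
  refine orbit_induction (x := w) (P := fun v => v.length = w.length) rfl ?_ ?_ (g • w)
    (MulAction.mem_orbit _ _)
  · intro v _ hv s
    rw [Gen.elt_smul_word, State.length_onWord, hv]
  · intro v _ hv s
    rw [← hv]
    conv_rhs => rw [← smul_inv_smul s.elt v, Gen.elt_smul_word, State.length_onWord]

theorem length_zeros (n : ℕ) : (zeros n).length = n := List.length_replicate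

theorem a_smul_cons_false (w : List Bool) :
    Gen.a.elt • (false :: w) = false :: Gen.b.elt • w := rfl

theorem b_smul_cons_true (w : List Bool) : Gen.b.elt • (true :: w) = false :: w := by
  simp [Gen.elt_smul_word, Gen.state, State.onWord, State.out, State.next, State.onWord_idle]

theorem b_smul_b_smul_cons (x : Bool) (w : List Bool) :
    Gen.b.elt • Gen.b.elt • (x :: w) = x :: Gen.a.elt • w := by
  cases x <;>
    simp [Gen.elt_smul_word, Gen.state, State.onWord, State.out, State.next, State.onWord_idle]

theorem a_smul_consSeq_false (τ : ℕ → Bool) :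
    Gen.a.elt • consSeq false τ = consSeq false (Gen.b.elt • τ) := by
  simp [Gen.elt_smul_seq, State.onSeq_consSeq, Gen.state, State.out, State.next]

theorem b_smul_consSeq_true (τ : ℕ → Bool) :
    Gen.b.elt • consSeq true τ = consSeq false τ := by
  simp [Gen.elt_smul_seq, State.onSeq_consSeq, Gen.state, State.out, State.next, State.onSeq_idle]

theorem b_smul_consSeq_false (τ : ℕ → Bool) :
    Gen.b.elt • consSeq false τ = consSeq true (Gen.a.elt • τ) := by
  simp [Gen.elt_smul_seq, State.onSeq_consSeq, Gen.state, State.out, State.next]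

theorem b_smul_b_smul_consSeq (x : Bool) (τ : ℕ → Bool) :
    Gen.b.elt • Gen.b.elt • consSeq x τ = consSeq x (Gen.a.elt • τ) := by
  cases x
  · rw [b_smul_consSeq_false, b_smul_consSeq_true]
  · rw [b_smul_consSeq_true, b_smul_consSeq_false]

/-- Prefixing a `0` preserves orbits: `a` and `b ^ 2` act on words starting with `0` as `b` and `a`
act on the rest. -/
theorem cons_false_mem_orbit {w v : List Bool} (h : w ∈ MulAction.orbit basilica v) :
    false :: w ∈ MulAction.orbit basilica (false :: v) := by
  have key : ∀ (s : Gen) (u : List Bool),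
      false :: s.elt • u ∈ MulAction.orbit basilica (false :: u) := by
    intro s u
    cases s
    · rw [← b_smul_b_smul_cons]
      exact smul_mem_orbit _ (MulAction.mem_orbit _ _)
    · rw [← a_smul_cons_false]
      exact MulAction.mem_orbit _ _
  refine orbit_induction (P := fun w => false :: w ∈ MulAction.orbit basilica (false :: v))
    (MulAction.mem_orbit_self _) ?_ ?_ w h
  · intro u _ hu s
    rw [← MulAction.orbit_eq_iff.2 hu]
    exact key s u
  · intro u _ hu s
    have := key s (s.elt⁻¹ • u)
    rw [smul_inv_smul] at this
    rw [← MulAction.orbit_eq_iff.2 hu, MulAction.orbit_eq_iff.2 this]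
    exact MulAction.mem_orbit_self _

/-- The Basilica group acts transitively on the words of each length. -/
theorem mem_orbit_zeros (w : List Bool) : w ∈ MulAction.orbit basilica (zeros w.length) := by
  induction w with
  | nil => exact MulAction.mem_orbit_self _
  | cons x w ih =>
    have h := cons_false_mem_orbit ih
    cases x
    · exact h
    · rw [← b_smul_cons_true w, ← MulAction.orbit_eq_iff, MulAction.orbit_smul,
        MulAction.orbit_eq_iff] at h
      exact h

theorem consSeq_false_mem_orbit {w v : ℕ → Bool} (h : w ∈ MulAction.orbit basilica v) :
    consSeq false w ∈ MulAction.orbit basilica (consSeq false v) := by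
  have key : ∀ (s : Gen) (u : ℕ → Bool),
      consSeq false (s.elt • u) ∈ MulAction.orbit basilica (consSeq false u) := by
    intro s u
    cases s
    · rw [← b_smul_b_smul_consSeq]
      exact smul_mem_orbit _ (MulAction.mem_orbit _ _)
    · rw [← a_smul_consSeq_false]
      exact MulAction.mem_orbit _ _
  refine orbit_induction (P := fun w => consSeq false w ∈ MulAction.orbit basilica
    (consSeq false v)) (MulAction.mem_orbit_self _) ?_ ?_ w h
  · intro u _ hu s
    rw [← MulAction.orbit_eq_iff.2 hu]
    exact key s u
  · intro u _ hu s
    have := key s (s.elt⁻¹ • u)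
    rw [smul_inv_smul] at this
    rw [← MulAction.orbit_eq_iff.2 hu, MulAction.orbit_eq_iff.2 this]
    exact MulAction.mem_orbit_self _

/-- Infinite words of the form `wτ` with `w` of a given length are in the same orbit. -/
theorem appSeq_mem_orbit (w : List Bool) (τ : ℕ → Bool) :
    appSeq w τ ∈ MulAction.orbit basilica (appSeq (zeros w.length) τ) := by
  induction w with
  | nil => exact MulAction.mem_orbit_self _
  | cons x w ih =>
    have h := consSeq_false_mem_orbit ih
    cases x
    · exact h
    · rw [← b_smul_consSeq_true (appSeq w τ), ← MulAction.orbit_eq_iff, MulAction.orbit_smul,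
        MulAction.orbit_eq_iff] at h
      exact h

theorem appSeq_zeros_zeroSeq (n : ℕ) : appSeq (zeros n) zeroSeq = zeroSeq := by
  induction n with
  | zero => rfl
  | succ n ih => exact (congrArg (consSeq false) ih).trans consSeq_zeroSeq

/-! ### The parity of the position of the last `1` -/

/-- The parity of the position of the last letter `1` of a word (positions are counted from `0`, and
`true` means odd), or `none` if all letters are `0`. -/
def lastOne : List Bool → Option Bool
  | [] => none
  | x :: w =>
    match lastOne w with
    | some p => some !p
    | none => if x then some false else none

/-- The parity of the positions where a generator may change the letters of `000⋯`. -/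
def Gen.par : Gen → Bool
  | .a => true
  | .b => false

theorem Gen.par_injective : Function.Injective Gen.par := by
  intro s t h
  cases s <;> cases t <;> first | rfl | exact absurd h (by simp [Gen.par])

theorem lastOne_eq_none_iff (w : List Bool) : lastOne w = none ↔ w = zeros w.length := by
  induction w with
  | nil => simp [lastOne, zeros]
  | cons x w ih =>
    rw [zeros, List.length_cons, List.replicate_succ, List.cons.injEq, ← zeros, ← ih, lastOne]
    cases lastOne w <;> cases x <;> simp

theorem lastOne_zeros (n : ℕ) : lastOne (zeros n) = none :=
  (lastOne_eq_none_iff _).2 (by rw [length_zeros])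

theorem smul_cases (s : Gen) (x : Bool) (w : List Bool) :
    s.elt • (x :: w) = match s, x with
      | .a, false => false :: Gen.b.elt • w
      | .a, true => true :: w
      | .b, false => true :: Gen.a.elt • w
      | .b, true => false :: w := by
  cases s <;> cases x <;>
    simp [Gen.elt_smul_word, Gen.state, State.onWord, State.out, State.next, State.onWord_idle]

/-- A generator preserves the parity of the position of the last `1`, unless it erases all `1`s. -/
theorem lastOne_smul_of_eq_some (s : Gen) (w : List Bool) (p : Bool) (h : lastOne w = some p) :
    lastOne (s.elt • w) = some p ∨ lastOne (s.elt • w) = none ∧ p = s.par := by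
  induction w generalizing s p with
  | nil => simp [lastOne] at h
  | cons x w ih =>
    rw [lastOne] at h
    cases hw : lastOne w with
    | none =>
      cases x <;> simp [hw] at h
      subst h
      cases s <;> simp [smul_cases, lastOne, hw, Gen.par]
    | some q =>
      simp only [hw, Option.some.injEq] at h
      subst h
      rcases s with _ | _ <;> rcases x with _ | _ <;> simp only [smul_cases, lastOne]
      · rcases ih .b q hw with h | ⟨h, rfl⟩ <;> simp [h, Gen.par]
      · simp [hw]
      · rcases ih .a q hw with h | ⟨h, rfl⟩ <;> simp [h, Gen.par]
      · simp [hw]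

/-- A generator creates letters `1` in `0 ⋯ 0` only at the positions of its own parity. -/
theorem lastOne_smul_of_eq_none (s : Gen) (w : List Bool) (h : lastOne w = none) :
    lastOne (s.elt • w) = none ∨ lastOne (s.elt • w) = some s.par := by
  induction w generalizing s with
  | nil => cases s <;> exact Or.inl rfl
  | cons x w ih =>
    have hw : lastOne w = none := by
      rw [lastOne] at h
      cases hw : lastOne w <;> simp_all
    have hx : x = false := by
      rw [lastOne, hw] at h
      cases x <;> simp_all
    subst hx
    rcases s with _ | _ <;> simp only [smul_cases, lastOne]
    · rcases ih .b hw with h | h <;> simp [h, Gen.par]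
    · rcases ih .a hw with h | h <;> simp [h, Gen.par]

theorem lastOne_append_true (w : List Bool) :
    lastOne (w ++ [true]) = some (decide (w.length % 2 = 1)) := by
  induction w with
  | nil => rfl
  | cons x w ih =>
    rw [List.cons_append, lastOne, ih]
    simp only [List.length_cons, Option.some.injEq]
    rcases Nat.mod_two_eq_zero_or_one w.length with h | h <;>
      simp [Nat.add_mod, h]

theorem lastOne_append_false (w : List Bool) : lastOne (w ++ [false]) = lastOne w := by
  induction w with
  | nil => rfl
  | cons x w ih => rw [List.cons_append, lastOne, ih, lastOne]

/-- Beyond its last `1` a word has no further `1`. -/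
theorem exists_of_lastOne_eq_some {w : List Bool} {p : Bool} (h : lastOne w = some p) :
    ∃ j, p = decide (j % 2 = 1) ∧ w.getD j false = true ∧ ∀ i > j, w.getD i false = false := by
  induction w generalizing p with
  | nil => simp [lastOne] at h
  | cons x w ih =>
    rw [lastOne] at h
    cases hw : lastOne w with
    | none =>
      cases x <;> simp [hw] at h
      subst h
      refine ⟨0, by simp, rfl, fun i hi => ?_⟩
      obtain ⟨i, rfl⟩ := Nat.exists_eq_succ_of_ne_zero hi.ne'
      rw [(lastOne_eq_none_iff w).1 hw]
      simp [zeros, List.getD_eq_getElem?_getD, List.getElem?_replicate]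
      split <;> rfl
    | some q =>
      simp only [hw, Option.some.injEq] at h
      subst h
      obtain ⟨j, rfl, h2, h3⟩ := ih hw
      refine ⟨j + 1, ?_, by simpa using h2, fun i hi => ?_⟩
      · rcases Nat.mod_two_eq_zero_or_one j with h | h <;> simp [Nat.add_mod, h]
      · obtain ⟨i, rfl⟩ := Nat.exists_eq_succ_of_ne_zero (Nat.ne_of_gt (Nat.zero_lt_of_lt hi))
        simpa using h3 i (by omega)

/-! ### The decorations -/

theorem schreierGraph_isLink {X : Type*} [MulAction basilica X] {e : X × Gen} {u v : X} :
    (schreierGraph Gen.elt).IsLink e u v ↔ s(e.1, e.2.elt • e.1) = s(u, v) :=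
  ⟨fun h => h.2, fun h => ⟨Set.mem_univ _, h⟩⟩

theorem schreierGraph_adj {X : Type*} [MulAction basilica X] {u v : X} :
    (schreierGraph Gen.elt).Adj u v ↔ ∃ s : Gen, v = s.elt • u ∨ u = s.elt • v := by
  constructor
  · rintro ⟨⟨x, s⟩, h⟩
    rw [schreierGraph_isLink] at h
    rcases Sym2.eq_iff.1 h with ⟨h1, h2⟩ | ⟨h1, h2⟩
    · exact ⟨s, Or.inl (h2.symm.trans (congrArg (s.elt • ·) h1))⟩
    · exact ⟨s, Or.inr (h2.symm.trans (congrArg (s.elt • ·) h1))⟩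
  · rintro ⟨s, rfl | rfl⟩
    · exact ⟨(u, s), schreierGraph_isLink.2 rfl⟩
    · exact ⟨(v, s), schreierGraph_isLink.2 Sym2.eq_swap⟩

/-- The adjacency relation of the `k`-th Schreier graph with the vertex `0 ⋯ 0` removed. -/
def PuncturedAdj (k : ℕ) : List Bool → List Bool → Prop :=
  ((finiteSchreier k).deleteVerts {zeros k}).Adj

theorem puncturedAdj_iff {k : ℕ} {u v : List Bool} :
    PuncturedAdj k u v ↔ (u.length = k ∧ u ≠ zeros k) ∧ (v.length = k ∧ v ≠ zeros k) ∧
      ∃ s : Gen, v = s.elt • u ∨ u = s.elt • v := by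
  have h : PuncturedAdj k u v ↔ (u.length = k ∧ u ≠ zeros k) ∧ (v.length = k ∧ v ≠ zeros k) ∧
      (schreierGraph Gen.elt).Adj u v := by
    constructor
    · rintro ⟨e, h, hu, hv⟩
      exact ⟨⟨hu.1, hu.2⟩, ⟨hv.1, hv.2⟩, e, h.1⟩
    · rintro ⟨hu, hv, e, h⟩
      exact ⟨e, ⟨h, hu.1, hv.1⟩, hu, hv⟩
  rw [h, schreierGraph_adj]

instance (k : ℕ) : Std.Symm (PuncturedAdj k) := by
  refine ⟨fun u v h => ?_⟩
  rw [puncturedAdj_iff] at h ⊢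
  obtain ⟨hu, hv, s, h⟩ := h
  exact ⟨hv, hu, s, h.symm⟩

theorem exists_lastOne_eq_some {k : ℕ} {w : List Bool} (h : w.length = k ∧ w ≠ zeros k) :
    ∃ p, lastOne w = some p := by
  cases hw : lastOne w with
  | none => exact absurd ((lastOne_eq_none_iff w).1 hw) (h.1 ▸ h.2)
  | some p => exact ⟨p, rfl⟩

/-- The parity of the position of the last `1` is constant on the components of the complement of
`0 ⋯ 0`. -/
theorem lastOne_eq_of_reflTransGen {k : ℕ} {u v : List Bool}
    (h : Relation.ReflTransGen (PuncturedAdj k) u v) : lastOne v = lastOne u := by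
  have key : ∀ (s : Gen) (u : List Bool), (u.length = k ∧ u ≠ zeros k) →
      (s.elt • u).length = k ∧ s.elt • u ≠ zeros k → lastOne (s.elt • u) = lastOne u := by
    intro s u hu hv
    obtain ⟨p, hp⟩ := exists_lastOne_eq_some hu
    obtain ⟨q, hq⟩ := exists_lastOne_eq_some hv
    rcases lastOne_smul_of_eq_some s u p hp with h | h
    · rw [h, hp]
    · exact absurd h.1 (by simp [hq])
  induction h with
  | refl => rfl
  | tail _ h ih =>
    obtain ⟨hu, hv, s, rfl | rfl⟩ := puncturedAdj_iff.1 h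
    · rw [key s _ hu hv, ih]
    · rw [← key s _ hv hu, ih]

/-- The two neighbours of `0 ⋯ 0` along the cycle of a generator are joined by the rest of that
cycle. -/
theorem reflTransGen_smul_inv_smul {k : ℕ} (s : Gen) (h : s.elt⁻¹ • zeros k ≠ zeros k) :
    s.elt • zeros k ≠ zeros k ∧
      Relation.ReflTransGen (PuncturedAdj k) (s.elt • zeros k) (s.elt⁻¹ • zeros k) := by
  have hex : ∃ n, s.elt ^ (n + 1) • zeros k = zeros k := by
    obtain ⟨m, n, hmn, h⟩ := (List.finite_length_eq Bool k).exists_lt_map_eq_of_forall_mem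
      (f := fun n : ℕ => s.elt ^ n • zeros k) fun n => by
        rw [Set.mem_ofPred_eq, length_smul_word, length_zeros]
    obtain ⟨d, rfl⟩ := Nat.exists_eq_add_of_lt hmn
    refine ⟨d, ?_⟩
    have h' : s.elt ^ m • zeros k = s.elt ^ (m + d + 1) • zeros k := h
    rw [add_assoc, pow_add, mul_smul] at h'
    exact (MulAction.injective _ h').symm
  classical
  -- `N + 1` is the length of the cycle.
  set N := Nat.find hex with hN
  have hNs : s.elt ^ (N + 1) • zeros k = zeros k := Nat.find_spec hex
  have hmin : ∀ n < N, s.elt ^ (n + 1) • zeros k ≠ zeros k := fun n hn => Nat.find_min hex hn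
  have hinv : s.elt⁻¹ • zeros k = s.elt ^ N • zeros k := by
    rw [inv_smul_eq_iff, ← mul_smul, ← pow_succ', hNs]
  have hN0 : 0 < N := by
    rcases Nat.eq_zero_or_pos N with h0 | h0
    · rw [hinv, h0] at h
      exact absurd (by simp) h
    · exact h0
  have h1 : s.elt • zeros k ≠ zeros k := by simpa using hmin 0 hN0
  refine ⟨h1, ?_⟩
  have key : ∀ n < N, Relation.ReflTransGen (PuncturedAdj k) (s.elt • zeros k)
      (s.elt ^ (n + 1) • zeros k) := by
    intro n
    induction n with
    | zero => intro _; simpa using Relation.ReflTransGen.refl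
    | succ n ih =>
      intro hn
      refine (ih (by omega)).tail (puncturedAdj_iff.2 ⟨⟨?_, hmin n (by omega)⟩,
        ⟨?_, hmin _ hn⟩, s, Or.inl ?_⟩)
      · rw [length_smul_word, length_zeros]
      · rw [length_smul_word, length_zeros]
      · rw [← mul_smul, ← pow_succ']
  rw [hinv]
  obtain ⟨n, hn⟩ := Nat.exists_eq_succ_of_ne_zero hN0.ne'
  rw [hn]
  exact key n (by omega)

/-- Every vertex other than `0 ⋯ 0` is joined in the complement of `0 ⋯ 0` to the image of `0 ⋯ 0`
under one of the generators. -/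
theorem exists_reflTransGen_smul_zeros {k : ℕ} {w : List Bool} (hw : w.length = k)
    (hne : w ≠ zeros k) : ∃ s : Gen, s.elt • zeros k ≠ zeros k ∧
      Relation.ReflTransGen (PuncturedAdj k) (s.elt • zeros k) w := by
  have hlen : ∀ y ∈ MulAction.orbit basilica (zeros k), y.length = k := by
    rintro _ ⟨g, rfl⟩
    rw [length_smul_word, length_zeros]
  refine orbit_induction (x := zeros k) (P := fun w => w ≠ zeros k → ∃ s : Gen,
    s.elt • zeros k ≠ zeros k ∧ Relation.ReflTransGen (PuncturedAdj k) (s.elt • zeros k) w)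
    (fun h => absurd rfl h) ?_ ?_ w (hw ▸ mem_orbit_zeros w) hne
  · intro y hy ih s hs
    by_cases h : y = zeros k
    · subst h
      exact ⟨s, hs, .refl⟩
    · obtain ⟨t, ht, hty⟩ := ih h
      exact ⟨t, ht, hty.tail (puncturedAdj_iff.2 ⟨⟨hlen y hy, h⟩,
        ⟨hlen _ (smul_mem_orbit _ hy), hs⟩, s, Or.inl rfl⟩)⟩
  · intro y hy ih s hs
    by_cases h : y = zeros k
    · subst h
      exact ⟨s, reflTransGen_smul_inv_smul s hs⟩
    · obtain ⟨t, ht, hty⟩ := ih h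
      exact ⟨t, ht, hty.tail (puncturedAdj_iff.2 ⟨⟨hlen y hy, h⟩,
        ⟨hlen _ (smul_mem_orbit _ hy), hs⟩, s, Or.inr (smul_inv_smul _ _).symm⟩)⟩

/-- The components of the complement of `0 ⋯ 0` are the level sets of `lastOne`. -/
theorem reflTransGen_of_lastOne_eq {k : ℕ} {u v : List Bool} (hu : u.length = k ∧ u ≠ zeros k)
    (hv : v.length = k ∧ v ≠ zeros k) (h : lastOne u = lastOne v) :
    Relation.ReflTransGen (PuncturedAdj k) u v := by
  obtain ⟨s, hs, hsu⟩ := exists_reflTransGen_smul_zeros hu.1 hu.2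
  obtain ⟨t, ht, htv⟩ := exists_reflTransGen_smul_zeros hv.1 hv.2
  have hpar : ∀ s : Gen, s.elt • zeros k ≠ zeros k →
      lastOne (s.elt • zeros k) = some s.par := by
    intro s hs
    rcases lastOne_smul_of_eq_none s _ (lastOne_zeros k) with h | h
    · rw [lastOne_eq_none_iff, length_smul_word, length_zeros] at h
      exact absurd h hs
    · exact h
  have hst : s = t := by
    have h1 := lastOne_eq_of_reflTransGen hsu
    have h2 := lastOne_eq_of_reflTransGen htv
    rw [hpar s hs] at h1
    rw [hpar t ht, ← h, h1] at h2
    exact Gen.par_injective (by simpa using h2)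
  subst hst
  exact (Relation.ReflTransGen.stdSymm.symm _ _ hsu).trans htv

/-- The decoration consists of the words whose last `1` does not stand at a position of the parity
of `k - 1`. -/
theorem mem_decoration_iff {k : ℕ} {p : Bool} (hk : 1 ≤ k) (hp : p = decide ((k - 1) % 2 = 1))
    (w : List Bool) :
    w ∈ (decoration k).vertexSet ↔ w.length = k ∧ lastOne w ≠ some p := by
  have h1 : w ∈ (decoration k).vertexSet ↔ w.length = k ∧ (w = zeros k ∨
      ¬ Relation.ReflTransGen (PuncturedAdj k) (zerosOne k) w) := Iff.rfl
  have hz : lastOne (zerosOne k) = some p := by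
    rw [zerosOne, lastOne_append_true, List.length_replicate, hp]
  have hzk : (zerosOne k).length = k ∧ zerosOne k ≠ zeros k := by
    refine ⟨by simp [zerosOne]; omega, fun h => ?_⟩
    rw [h, lastOne_zeros] at hz
    simp at hz
  rw [h1]
  refine and_congr_right fun hw => ?_
  by_cases h0 : w = zeros k
  · simp [h0, lastOne_zeros]
  · simp only [h0, false_or]
    refine not_congr ⟨fun h => (lastOne_eq_of_reflTransGen h).trans hz, fun h => ?_⟩
    exact reflTransGen_of_lastOne_eq hzk ⟨hw, h0⟩ (hz.trans h.symm)

/-- A word of a decoration ends in `0`. -/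
theorem exists_eq_append_false {k : ℕ} {w : List Bool} (hk : 1 ≤ k)
    (h : w ∈ (decoration k).vertexSet) : ∃ v, v.length = k - 1 ∧ w = v ++ [false] := by
  rw [mem_decoration_iff hk rfl] at h
  obtain ⟨h1, h2⟩ := h
  obtain ⟨v, x, rfl⟩ : ∃ v x, w = v ++ [x] :=
    ⟨w.dropLast, w.getLast (by rintro rfl; simp at h1; omega),
      (List.dropLast_append_getLast _).symm⟩
  have hv : v.length = k - 1 := by simp at h1; omega
  cases x with
  | false => exact ⟨v, hv, rfl⟩
  | true => rw [lastOne_append_true, hv] at h2; exact absurd rfl h2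

theorem decoration_isLink {k : ℕ} {e : List Bool × Gen} {u v : List Bool} :
    (decoration k).IsLink e u v ↔ s(e.1, e.2.elt • e.1) = s(u, v) ∧
      u ∈ (decoration k).vertexSet ∧ v ∈ (decoration k).vertexSet := by
  constructor
  · rintro ⟨h, hu, hv⟩
    exact ⟨schreierGraph_isLink.1 h.1, hu, hv⟩
  · rintro ⟨h, hu, hv⟩
    exact ⟨⟨schreierGraph_isLink.2 h, hu.1, hv.1⟩, hu, hv⟩

theorem mem_decoration_edgeSet {k : ℕ} {e : List Bool × Gen} :
    e ∈ (decoration k).edgeSet ↔ e.1 ∈ (decoration k).vertexSet ∧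
      e.2.elt • e.1 ∈ (decoration k).vertexSet := by
  constructor
  · intro h
    obtain ⟨u, v, huv⟩ := Graph.exists_isLink_of_mem_edgeSet h
    rw [decoration_isLink] at huv
    obtain ⟨h, hu, hv⟩ := huv
    rcases Sym2.eq_iff.1 h with ⟨rfl, rfl⟩ | ⟨rfl, rfl⟩
    exacts [⟨hu, hv⟩, ⟨hv, hu⟩]
  · rintro ⟨hu, hv⟩
    exact (decoration_isLink.2 ⟨rfl, hu, hv⟩).edge_mem

/-- The edge from the root along the generator whose parity is that of `k - 1` leaves the
decoration. -/
theorem smul_zeros_notMem_decoration {k : ℕ} {s : Gen} (hk : 1 ≤ k)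
    (hs : s.par = decide ((k - 1) % 2 = 1)) :
    s.elt • zeros k ∉ (decoration k).vertexSet := by
  rw [mem_decoration_iff hk hs, not_and_not_right]
  intro _
  rcases lastOne_smul_of_eq_none s _ (lastOne_zeros k) with h | h
  · rw [lastOne_eq_none_iff, length_smul_word, length_zeros] at h
    obtain ⟨k, rfl⟩ := Nat.exists_eq_add_of_le' hk
    rw [zeros, List.replicate_succ, smul_cases] at h
    cases s with
    | b => simp at h
    | a =>
      cases k with
      | zero => simp [Gen.par] at hs
      | succ k =>
        simp only [List.replicate_succ, smul_cases] at h
        simp at h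
  · exact h

/-- A generator maps the words of a decoration to words of the decoration, with the exception of
the root and the generator whose parity is that of `k - 1`. -/
theorem smul_mem_decoration {k : ℕ} {s t : Gen} {w : List Bool} (hk : 1 ≤ k)
    (ht : t.par = decide ((k - 1) % 2 = 1)) (hw : w ∈ (decoration k).vertexSet)
    (h : ¬ (w = zeros k ∧ s = t)) : s.elt • w ∈ (decoration k).vertexSet := by
  rw [mem_decoration_iff hk ht] at hw ⊢
  refine ⟨by rw [length_smul_word, hw.1], ?_⟩
  cases hl : lastOne w with
  | none =>
    have hst : s ≠ t := fun hst => h ⟨hw.1 ▸ (lastOne_eq_none_iff w).1 hl, hst⟩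
    rcases lastOne_smul_of_eq_none s w hl with h | h <;> rw [h]
    · simp
    · simpa using fun h => hst (Gen.par_injective h)
  | some p =>
    rcases lastOne_smul_of_eq_some s w p hl with h | h
    · rw [h, ← hl]; exact hw.2
    · rw [h.1]; simp

/-- The analogue of `smul_mem_decoration` for the inverses of the generators. -/
theorem inv_smul_mem_decoration {k : ℕ} {s t : Gen} {w : List Bool} (hk : 1 ≤ k)
    (ht : t.par = decide ((k - 1) % 2 = 1)) (hw : w ∈ (decoration k).vertexSet)
    (h : ¬ (w = zeros k ∧ s = t)) : s.elt⁻¹ • w ∈ (decoration k).vertexSet := by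
  rw [mem_decoration_iff hk ht] at hw ⊢
  refine ⟨by rw [length_smul_word, hw.1], fun hl => ?_⟩
  rcases lastOne_smul_of_eq_some s _ _ hl with h' | ⟨h', h''⟩ <;> rw [smul_inv_smul] at h'
  · exact hw.2 h'
  · exact h ⟨hw.1 ▸ (lastOne_eq_none_iff w).1 h', (Gen.par_injective h'').symm⟩

/-! ### The lines through `000⋯` -/

/-- The generator that moves along a line: `b` on the first, `a` on the second. -/
def Line.gen : Line → Gen
  | .one => .b
  | .two => .a

theorem Line.gen_injective : Function.Injective Line.gen := by
  intro i j h
  cases i <;> cases j <;> first | rfl | exact absurd h (by simp [Line.gen])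

theorem Line.gen_surjective : Function.Surjective Line.gen
  | .a => ⟨.two, rfl⟩
  | .b => ⟨.one, rfl⟩

theorem one_le_height (i : Line) (n : ℤ) : 1 ≤ height i n := by
  cases i <;> simp [height]

/-- The parity of the generator of a line is the one excluded in the decorations on this line. -/
theorem par_gen_eq (i : Line) (n : ℤ) : i.gen.par = decide ((height i n - 1) % 2 = 1) := by
  cases i <;> simp [height, Line.gen, Gen.par]

/-- The infinite word at the point `n` of a line. -/
def linePt (i : Line) (n : ℤ) : ℕ → Bool := i.gen.elt ^ n • zeroSeq

theorem linePt_zero (i : Line) : linePt i 0 = zeroSeq := by simp [linePt]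

theorem gen_smul_linePt (i : Line) (n : ℤ) : i.gen.elt • linePt i n = linePt i (n + 1) := by
  rw [linePt, linePt, ← mul_smul, ← zpow_one_add, add_comm]

theorem gen_inv_smul_linePt (i : Line) (n : ℤ) : i.gen.elt⁻¹ • linePt i n = linePt i (n - 1) := by
  rw [inv_smul_eq_iff, gen_smul_linePt, sub_add_cancel]

theorem linePt_two (n : ℤ) : linePt .two n = consSeq false (linePt .one n) := by
  conv_lhs => rw [linePt, ← consSeq_zeroSeq]
  exact zpow_smul_semiconj a_smul_consSeq_false n zeroSeq

theorem linePt_one_two_mul (n : ℤ) : linePt .one (2 * n) = consSeq false (linePt .two n) := by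
  have h : ∀ τ, Gen.b.elt ^ (2 : ℤ) • consSeq false τ = consSeq false (Gen.a.elt • τ) := fun τ => by
    rw [zpow_two, mul_smul, b_smul_b_smul_consSeq]
  conv_lhs => rw [linePt, ← consSeq_zeroSeq]
  rw [zpow_mul]
  exact zpow_smul_semiconj h n zeroSeq

theorem linePt_one_two_mul_add_one (n : ℤ) :
    linePt .one (2 * n + 1) = consSeq true (linePt .two (n + 1)) := by
  rw [← gen_smul_linePt, linePt_one_two_mul, ← gen_smul_linePt .two]
  exact b_smul_consSeq_false _

theorem linePt_one_apply_odd (j : ℕ) (n : ℤ) : linePt .one n (2 * j + 1) = false := by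
  induction j generalizing n with
  | zero =>
    obtain ⟨m, rfl | rfl⟩ := Int.even_or_odd' n
    · rw [linePt_one_two_mul, linePt_two]; rfl
    · rw [linePt_one_two_mul_add_one, linePt_two]; rfl
  | succ j ih =>
    obtain ⟨m, rfl | rfl⟩ := Int.even_or_odd' n
    · rw [linePt_one_two_mul, linePt_two]; exact ih m
    · rw [linePt_one_two_mul_add_one, linePt_two]; exact ih (m + 1)

/-- On each line only the letters at the positions of one parity ever change. -/
theorem linePt_apply_eq_false (i : Line) (n : ℤ) {j : ℕ} (h : i.gen.par ≠ decide (j % 2 = 1)) :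
    linePt i n j = false := by
  cases i with
  | one =>
    have hj : j % 2 = 1 := by by_contra hj; simp [hj, Line.gen, Gen.par] at h
    rw [show j = 2 * (j / 2) + 1 by omega]
    exact linePt_one_apply_odd _ _
  | two =>
    have hj : j % 2 = 0 := by by_contra hj; simp [hj, Line.gen, Gen.par] at h
    rw [linePt_two]
    cases j with
    | zero => rfl
    | succ j =>
      rw [show j = 2 * (j / 2) + 1 by omega]
      exact linePt_one_apply_odd _ _

theorem linePt_one_two_pow_mul (k : ℕ) (m : ℤ) :
    linePt .one (2 ^ k * m) = appSeq (zeros (2 * k)) (linePt .one m) := by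
  induction k with
  | zero => simp [zeros, appSeq]
  | succ k ih =>
    rw [pow_succ', mul_assoc, linePt_one_two_mul, linePt_two, ih]
    rfl

/-- The point `n ≠ 0` of a line reads `0 ⋯ 01⋯`, where the number of zeros is one less than the
height of the decoration attached there. -/
theorem exists_linePt_eq (i : Line) {n : ℤ} (hn : n ≠ 0) :
    ∃ τ, linePt i n = appSeq (zeros (height i n - 1)) (consSeq true τ) := by
  have h1 : ∃ τ, linePt .one n = appSeq (zeros (2 * padicValInt 2 n)) (consSeq true τ) := by
    have hA : n ∈ A (padicValInt 2 n) := (mem_A_iff _ _).2 ⟨hn, rfl⟩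
    obtain ⟨c, hc⟩ := (Int.modEq_iff_dvd.1 (show n ≡ 2 ^ padicValInt 2 n
      [ZMOD 2 ^ (padicValInt 2 n + 1)] from hA))
    have hm : n = 2 ^ padicValInt 2 n * (2 * (-c) + 1) := by
      rw [pow_succ] at hc
      linear_combination -hc
    refine ⟨linePt .two (-c + 1), ?_⟩
    conv_lhs => rw [hm]
    rw [linePt_one_two_pow_mul, linePt_one_two_mul_add_one]
  cases i with
  | one => exact h1
  | two =>
    obtain ⟨τ, h⟩ := h1
    refine ⟨τ, ?_⟩
    rw [linePt_two, h]
    rfl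

theorem linePt_height (i : Line) {n : ℤ} (hn : n ≠ 0) : linePt i n (height i n - 1) = true := by
  obtain ⟨τ, h⟩ := exists_linePt_eq i hn
  have := appSeq_apply_add (zeros (height i n - 1)) (consSeq true τ) 0
  rw [← h, length_zeros] at this
  exact this

theorem linePt_injective (i : Line) : Function.Injective (linePt i) := by
  intro n m h
  by_contra hnm
  have h0 : linePt i (n - m) = zeroSeq := by
    have h' : i.gen.elt ^ n • zeroSeq = i.gen.elt ^ m • zeroSeq := h
    rw [linePt, sub_eq_neg_add, zpow_add, mul_smul, h', ← mul_smul, ← zpow_add]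
    simp
  have h1 := linePt_height i (sub_ne_zero.2 hnm)
  rw [h0] at h1
  exact Bool.false_ne_true h1

/-! ### The vertices of `Γ_(4)` as infinite words -/

/-- The tail of the point `n` of a line behind its initial zeros. -/
def lineTail (i : Line) (n : ℤ) : ℕ → Bool := fun j => linePt i n (height i n - 1 + j)

theorem appSeq_lineTail (i : Line) {n : ℤ} (hn : n ≠ 0) :
    appSeq (zeros (height i n - 1)) (lineTail i n) = linePt i n := by
  obtain ⟨τ, h⟩ := exists_linePt_eq i hn
  conv_rhs => rw [h]
  congr 1
  funext j
  have := appSeq_apply_add (zeros (height i n - 1)) (consSeq true τ) j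
  rw [← h, length_zeros] at this
  exact this

theorem lineTail_zero (i : Line) {n : ℤ} (hn : n ≠ 0) : lineTail i n 0 = true := linePt_height i hn

/-- The infinite word corresponding to a vertex of `Γ_(4)`: in the word `w` of the decoration
attached at the point `n` of a line, the last letter (which is `0`) is replaced by the tail of that
point. -/
def Vertex4.point : Vertex4 → ℕ → Bool
  | .origin => zeroSeq
  | .deco i n w => appSeq w.dropLast (lineTail i n)

theorem deco_mem_vertices4 {i : Line} {n : ℤ} {w : List Bool} (hn : n ≠ 0)
    (hw : w ∈ (decoration (height i n)).vertexSet) : Vertex4.deco i n w ∈ vertices4 := ⟨hn, hw⟩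

theorem point_append_false (i : Line) (n : ℤ) (v : List Bool) :
    (Vertex4.deco i n (v ++ [false])).point = appSeq v (lineTail i n) := by
  rw [Vertex4.point, List.dropLast_concat]

theorem point_linePoint (i : Line) (n : ℤ) : (linePoint i n).point = linePt i n := by
  by_cases hn : n = 0
  · simp [linePoint, hn, Vertex4.point, linePt_zero]
  · rw [linePoint, if_neg hn, ← appSeq_lineTail i hn, Vertex4.point, zeros, List.dropLast_replicate]
    rfl

/-- The generators act on the words of a decoration and on the corresponding infinite words in the
same way: the state reached before the last letter fixes this letter `0`, so it is not `b`, and then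
it also fixes every tail beginning with `1`. -/
theorem smul_point {i : Line} {n : ℤ} (hn : n ≠ 0) {w : List Bool} (s : Gen)
    (hw : w ∈ (decoration (height i n)).vertexSet)
    (hs : s.elt • w ∈ (decoration (height i n)).vertexSet) :
    s.elt • (Vertex4.deco i n w).point = (Vertex4.deco i n (s.elt • w)).point := by
  obtain ⟨v, hv, rfl⟩ := exists_eq_append_false (one_le_height i n) hw
  obtain ⟨u, hu, h⟩ := exists_eq_append_false (one_le_height i n) hs
  rw [h, point_append_false, point_append_false, Gen.elt_smul_seq, State.onSeq_appSeq]
  rw [Gen.elt_smul_word, State.onWord_append] at h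
  obtain ⟨rfl, h2⟩ := List.append_inj h (by rw [State.length_onWord, hv, hu])
  congr 1
  rw [← consSeq_head_tail (lineTail i n), lineTail_zero i hn, State.onSeq_consSeq,
    State.next_true, State.onSeq_idle]
  congr 1
  -- Since `s • w` ends in `0`, the state reached after `v` is not `b`.
  revert h2
  cases s.state.after v <;> simp [State.onWord, State.out]

/-- Equal infinite words come from decorations of equal height. Otherwise the longer word `w'`
contains the letter `1` at the position `L` where the tail of the first infinite word begins, and
beyond `L` that infinite word has letters `1` only at positions of the parity of `L`. If the two lines differ, this
excludes the first letter `1` of the tail of the second infinite word; if they agree, it excludes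
that the last `1` of `w'` has the parity required in a decoration. -/
theorem height_le_of_point_eq {i i' : Line} {n n' : ℤ} (hn : n ≠ 0) (hn' : n' ≠ 0)
    {w w' : List Bool} (hw : w ∈ (decoration (height i n)).vertexSet)
    (hw' : w' ∈ (decoration (height i' n')).vertexSet)
    (h : (Vertex4.deco i n w).point = (Vertex4.deco i' n' w').point) :
    height i' n' ≤ height i n := by
  by_contra! hlt
  have hpos := one_le_height i n
  have hpar := par_gen_eq i n
  have hpar' := par_gen_eq i' n'
  have hlast := ((mem_decoration_iff (one_le_height i' n') hpar' w').1 hw').2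
  obtain ⟨v, hv, rfl⟩ := exists_eq_append_false (one_le_height i n) hw
  obtain ⟨v', hv', rfl⟩ := exists_eq_append_false (one_le_height i' n') hw'
  rw [lastOne_append_false] at hlast
  rw [point_append_false, point_append_false] at h
  set L := height i n - 1 with hL
  set L' := height i' n' - 1 with hL'
  have hge : ∀ j, appSeq v (lineTail i n) (L + j) = linePt i n (L + j) := fun j => by
    rw [← hv, appSeq_apply_add, hv]; rfl
  have hzero : ∀ j > L, i.gen.par ≠ decide (j % 2 = 1) → appSeq v (lineTail i n) j = false := by
    intro j hj hp
    obtain ⟨d, rfl⟩ := Nat.exists_eq_add_of_lt hj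
    rw [add_assoc, hge, ← add_assoc]
    exact linePt_apply_eq_false i n hp
  by_cases hp : i.gen.par = i'.gen.par
  · have hvL : v'.getD L false = true := by
      rw [← appSeq_apply_lt v' (lineTail i' n') L (by omega), ← h]
      have := hge 0
      rw [add_zero] at this
      rw [this]
      exact linePt_height i hn
    cases hl : lastOne v' with
    | none =>
      rw [(lastOne_eq_none_iff v').1 hl, zeros, List.getD_eq_getElem?_getD,
        List.getElem?_replicate] at hvL
      split at hvL <;> simp at hvL
    | some q =>
      obtain ⟨j, rfl, h2, h3⟩ := exists_of_lastOne_eq_some hl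
      have hjL : L ≤ j := by
        by_contra! hjL
        rw [h3 L hjL] at hvL
        simp at hvL
      have hjL' : j < L' := by
        by_contra! hjL'
        rw [List.getD_eq_default _ _ (by omega)] at h2
        simp at h2
      rw [hl, ← hp] at hlast
      have hne : i.gen.par ≠ decide (j % 2 = 1) := fun h => hlast (by rw [h])
      have hj : L < j := lt_of_le_of_ne hjL (by rintro h; rw [← h] at hne; exact hne hpar)
      have := hzero j hj hne
      rw [h, appSeq_apply_lt _ _ _ (by omega), h2] at this
      simp at this
  · have := hzero L' (by omega) (by rwa [← hpar'])
    rw [h] at this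
    have h2 := appSeq_apply_add v' (lineTail i' n') 0
    rw [lineTail_zero i' hn', add_zero, hv', this] at h2
    simp at h2

/-- Different vertices of `Γ_(4)` give different infinite words: the height of the decoration is
determined by `height_le_of_point_eq`; it determines the line, the word `w` and the tail. -/
theorem point_injOn : Set.InjOn Vertex4.point vertices4 := by
  have h0 : ∀ i n w, Vertex4.deco i n w ∈ vertices4 → (Vertex4.deco i n w).point ≠ zeroSeq := by
    rintro i n w ⟨hn, hw⟩ h
    obtain ⟨v, hv, rfl⟩ := exists_eq_append_false (one_le_height i n) hw
    rw [point_append_false] at h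
    have h2 := appSeq_apply_add v (lineTail i n) 0
    rw [lineTail_zero i hn, h] at h2
    exact Bool.false_ne_true h2
  rintro (_ | ⟨i, n, w⟩) hx (_ | ⟨i', n', w'⟩) hy h
  · rfl
  · exact absurd h.symm (h0 _ _ _ hy)
  · exact absurd h (h0 _ _ _ hx)
  · obtain ⟨hn, hw⟩ := hx
    obtain ⟨hn', hw'⟩ := hy
    have hh : height i n = height i' n' :=
      le_antisymm (height_le_of_point_eq hn' hn hw' hw h.symm)
        (height_le_of_point_eq hn hn' hw hw' h)
    obtain ⟨v, hv, rfl⟩ := exists_eq_append_false (one_le_height i n) hw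
    obtain ⟨v', hv', rfl⟩ := exists_eq_append_false (one_le_height i' n') hw'
    rw [point_append_false, point_append_false] at h
    obtain ⟨rfl, ht⟩ := appSeq_inj (by rw [hv, hv', hh]) h
    obtain rfl : i = i' := Line.gen_injective (Gen.par_injective (by
      rw [par_gen_eq i n, par_gen_eq i' n', hh]))
    obtain rfl : n = n' := linePt_injective i (by
      rw [← appSeq_lineTail i hn, ← appSeq_lineTail i hn', hh, ht])
    rfl

theorem point_mem_orbit {x : Vertex4} (hx : x ∈ vertices4) :
    x.point ∈ MulAction.orbit basilica zeroSeq := by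
  rcases x with _ | ⟨i, n, w⟩
  · exact MulAction.mem_orbit_self _
  · obtain ⟨hn, hw⟩ := hx
    obtain ⟨v, hv, rfl⟩ := exists_eq_append_false (one_le_height i n) hw
    have h := appSeq_mem_orbit v (lineTail i n)
    rw [hv, appSeq_lineTail i hn] at h
    rw [point_append_false, ← MulAction.orbit_eq_iff.2
      (show linePt i n ∈ MulAction.orbit basilica zeroSeq from MulAction.mem_orbit _ _)]
    exact h

/-- Every infinite word in the orbit of `000⋯` comes from a vertex of `Γ_(4)`, because the set of
these words is stable under the generators and their inverses. -/
theorem exists_point_eq {η : ℕ → Bool} (h : η ∈ MulAction.orbit basilica zeroSeq) :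
    ∃ x ∈ vertices4, x.point = η := by
  refine orbit_induction (P := fun η => ∃ x ∈ vertices4, x.point = η)
    ⟨.origin, trivial, rfl⟩ ?_ ?_ η h
  · rintro _ - ⟨x, hx, rfl⟩ s
    obtain ⟨j, rfl⟩ := Line.gen_surjective s
    have key : ∀ n, ∃ x ∈ vertices4, x.point = j.gen.elt • linePt j n := fun n =>
      ⟨linePoint j (n + 1), linePoint_mem _ _, by rw [point_linePoint, gen_smul_linePt]⟩
    rcases x with _ | ⟨i, n, w⟩
    · rw [Vertex4.point, ← linePt_zero j]
      exact key 0
    · obtain ⟨hn, hw⟩ := hx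
      by_cases hs : w = zeros (height i n) ∧ j.gen = i.gen
      · obtain ⟨rfl, hji⟩ := hs
        obtain rfl := Line.gen_injective hji
        have : (Vertex4.deco j n (zeros (height j n))).point = linePt j n := by
          rw [← point_linePoint, linePoint, if_neg hn]
        rw [this]
        exact key n
      · have hsw := smul_mem_decoration (one_le_height i n) (par_gen_eq i n) hw hs
        exact ⟨_, deco_mem_vertices4 hn hsw, (smul_point hn _ hw hsw).symm⟩
  · rintro _ - ⟨x, hx, rfl⟩ s
    obtain ⟨j, rfl⟩ := Line.gen_surjective s
    have key : ∀ n, ∃ x ∈ vertices4, x.point = j.gen.elt⁻¹ • linePt j n := fun n =>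
      ⟨linePoint j (n - 1), linePoint_mem _ _, by rw [point_linePoint, gen_inv_smul_linePt]⟩
    rcases x with _ | ⟨i, n, w⟩
    · rw [Vertex4.point, ← linePt_zero j]
      exact key 0
    · obtain ⟨hn, hw⟩ := hx
      by_cases hs : w = zeros (height i n) ∧ j.gen = i.gen
      · obtain ⟨rfl, hji⟩ := hs
        obtain rfl := Line.gen_injective hji
        have : (Vertex4.deco j n (zeros (height j n))).point = linePt j n := by
          rw [← point_linePoint, linePoint, if_neg hn]
        rw [this]
        exact key n
      · have hsw := inv_smul_mem_decoration (one_le_height i n) (par_gen_eq i n) hw hs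
        refine ⟨_, deco_mem_vertices4 hn hsw, ?_⟩
        rw [eq_inv_smul_iff, smul_point hn _ hsw (by rwa [smul_inv_smul]), smul_inv_smul]

/-! ### The isomorphism -/

theorem orbitalSchreier_isLink {ξ : ℕ → Bool} {e : (ℕ → Bool) × Gen} {u v : ℕ → Bool} :
    (orbitalSchreier ξ).IsLink e u v ↔ s(e.1, e.2.elt • e.1) = s(u, v) ∧
      u ∈ MulAction.orbit basilica ξ ∧ v ∈ MulAction.orbit basilica ξ :=
  and_congr_left fun _ => schreierGraph_isLink

theorem mem_orbitalSchreier_edgeSet {ξ : ℕ → Bool} {e : (ℕ → Bool) × Gen} :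
    e ∈ (orbitalSchreier ξ).edgeSet ↔ e.1 ∈ MulAction.orbit basilica ξ := by
  constructor
  · intro h
    obtain ⟨u, v, huv⟩ := Graph.exists_isLink_of_mem_edgeSet h
    obtain ⟨h, hu, hv⟩ := orbitalSchreier_isLink.1 huv
    rcases Sym2.eq_iff.1 h with ⟨h, -⟩ | ⟨h, -⟩ <;> rw [h]
    exacts [hu, hv]
  · intro h
    exact (orbitalSchreier_isLink.2 ⟨rfl, h, smul_mem_orbit _ h⟩).edge_mem

/-- The edge of the orbital Schreier graph of `000⋯` corresponding to an edge of `Γ_(4)`. -/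
def Edge4.image : Edge4 → (ℕ → Bool) × Gen
  | .line i n => (linePt i n, i.gen)
  | .deco i n e => ((Vertex4.deco i n e.1).point, e.2)

theorem map_point_ends4 {e : Edge4} (he : e ∈ edges4) :
    (ends4 e).map Vertex4.point = s(e.image.1, e.image.2.elt • e.image.1) := by
  rcases e with ⟨i, n⟩ | ⟨i, n, w, s⟩
  · rw [ends4, Sym2.map_mk, point_linePoint, point_linePoint, ← gen_smul_linePt]
    rfl
  · obtain ⟨hn, he⟩ := he
    obtain ⟨h1, h2⟩ := mem_decoration_edgeSet.1 he
    rw [ends4, Sym2.map_mk, ← smul_point hn s h1 h2]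
    rfl

theorem image_mem_edgeSet {e : Edge4} (he : e ∈ edges4) :
    e.image ∈ (orbitalSchreier zeroSeq).edgeSet := by
  rw [mem_orbitalSchreier_edgeSet]
  rcases e with ⟨i, n⟩ | ⟨i, n, w, s⟩
  · exact MulAction.mem_orbit _ _
  · exact point_mem_orbit (deco_mem_vertices4 he.1 (mem_decoration_edgeSet.1 he.2).1)

/-- The edges of the lines and of the decorations have different images, since a decoration contains
no edge from its root along the generator of the line. -/
theorem image_injOn : Set.InjOn Edge4.image edges4 := by
  have key : ∀ i n i' n' w s, Edge4.deco i' n' (w, s) ∈ edges4 →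
      (Edge4.line i n).image ≠ (Edge4.deco i' n' (w, s)).image := by
    rintro i n i' n' w s ⟨hn', he⟩ h
    obtain ⟨h1, h2⟩ := mem_decoration_edgeSet.1 he
    have h3 : linePt i n = (Vertex4.deco i' n' w).point := congrArg Prod.fst h
    have h4 : i.gen = s := congrArg Prod.snd h
    rw [← point_linePoint] at h3
    have h5 := point_injOn (linePoint_mem i n) (deco_mem_vertices4 hn' h1) h3
    by_cases hn : n = 0
    · simp [linePoint, hn] at h5
    · rw [linePoint, if_neg hn] at h5
      injection h5 with h6 h7 h8
      subst h6 h7 h8 h4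
      exact smul_zeros_notMem_decoration (one_le_height i n) (par_gen_eq i n) h2
  rintro (⟨i, n⟩ | ⟨i, n, w, s⟩) he (⟨i', n'⟩ | ⟨i', n', w', s'⟩) he' h
  · obtain rfl : i = i' := Line.gen_injective (congrArg Prod.snd h)
    obtain rfl : n = n' := linePt_injective i (congrArg Prod.fst h)
    rfl
  · exact absurd h (key _ _ _ _ _ _ he')
  · exact absurd h.symm (key _ _ _ _ _ _ he)
  · have h1 : s = s' := congrArg Prod.snd h
    have h2 := point_injOn (deco_mem_vertices4 he.1 (mem_decoration_edgeSet.1 he.2).1)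
      (deco_mem_vertices4 he'.1 (mem_decoration_edgeSet.1 he'.2).1)
      (congrArg Prod.fst h)
    injection h2 with h6 h7 h8
    subst h6 h7 h8 h1
    rfl

theorem exists_image_eq {e : (ℕ → Bool) × Gen} (he : e ∈ (orbitalSchreier zeroSeq).edgeSet) :
    ∃ e' ∈ edges4, e'.image = e := by
  obtain ⟨η, s⟩ := e
  obtain ⟨x, hx, rfl⟩ := exists_point_eq (mem_orbitalSchreier_edgeSet.1 he)
  obtain ⟨j, rfl⟩ := Line.gen_surjective s
  rcases x with _ | ⟨i, n, w⟩
  · exact ⟨.line j 0, trivial, by rw [Edge4.image, linePt_zero]; rfl⟩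
  · obtain ⟨hn, hw⟩ := hx
    by_cases hs : w = zeros (height i n) ∧ j.gen = i.gen
    · obtain ⟨rfl, hji⟩ := hs
      obtain rfl := Line.gen_injective hji
      refine ⟨.line j n, trivial, ?_⟩
      rw [Edge4.image, ← point_linePoint, linePoint, if_neg hn]
    · exact ⟨.deco i n (w, j.gen), ⟨hn, mem_decoration_edgeSet.2
        ⟨hw, smul_mem_decoration (one_le_height i n) (par_gen_eq i n) hw hs⟩⟩, rfl⟩

/-- `Γ_(4)` is the orbital Schreier graph of `000⋯`. -/
theorem nonempty_iso_zeroSeq : Nonempty (GraphIso Gamma4 (orbitalSchreier zeroSeq)) := by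
  refine GraphIso.nonempty_of_bijective (fun x => ⟨x.1.point, point_mem_orbit x.2⟩)
    (fun e => ⟨e.1.image, image_mem_edgeSet e.2⟩) ⟨?_, ?_⟩ ⟨?_, ?_⟩ ?_
  · intro x y h
    exact Subtype.ext (point_injOn x.2 y.2 (congrArg Subtype.val h))
  · rintro ⟨η, hη⟩
    obtain ⟨x, hx, rfl⟩ := exists_point_eq hη
    exact ⟨⟨x, hx⟩, rfl⟩
  · intro x y h
    exact Subtype.ext (image_injOn x.2 y.2 (congrArg Subtype.val h))
  · rintro ⟨e, he⟩
    obtain ⟨e', he', rfl⟩ := exists_image_eq he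
    exact ⟨⟨e', he'⟩, rfl⟩
  · rintro ⟨e, he⟩ x y ⟨-, h⟩
    refine orbitalSchreier_isLink.2 ⟨?_, point_mem_orbit x.2, point_mem_orbit y.2⟩
    have h' := congrArg (Sym2.map Vertex4.point) h
    rw [map_point_ends4 he] at h'
    exact h'

/-! ### Connectedness -/

/-- Adjacency in the underlying simple graph of an orbital Schreier graph. -/
theorem orbitalSchreier_adj {ξ : ℕ → Bool} {u v : (orbitalSchreier ξ).vertexSet} :
    (orbitalSchreier ξ).toSimpleGraph.Adj u v ↔
      u ≠ v ∧ ∃ s : Gen, (v : ℕ → Bool) = s.elt • u.1 ∨ (u : ℕ → Bool) = s.elt • v.1 := by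
  refine and_congr_right fun _ => ?_
  rw [← schreierGraph_adj]
  constructor
  · rintro ⟨e, h, -⟩
    exact ⟨e, h⟩
  · rintro ⟨e, h⟩
    exact ⟨e, h, u.2, v.2⟩

theorem orbitalSchreier_preconnected (ξ : ℕ → Bool) :
    (orbitalSchreier ξ).toSimpleGraph.Preconnected := by
  have step : ∀ (u v : (orbitalSchreier ξ).vertexSet),
      (∃ s : Gen, (v : ℕ → Bool) = s.elt • u.1 ∨ (u : ℕ → Bool) = s.elt • v.1) →
      (orbitalSchreier ξ).toSimpleGraph.Reachable u v := by
    intro u v h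
    by_cases huv : u = v
    · rw [huv]
    · exact (orbitalSchreier_adj.2 ⟨huv, h⟩).reachable
  have key : ∀ η ∈ MulAction.orbit basilica ξ, ∃ h : η ∈ (orbitalSchreier ξ).vertexSet,
      (orbitalSchreier ξ).toSimpleGraph.Reachable ⟨ξ, MulAction.mem_orbit_self ξ⟩ ⟨η, h⟩ := by
    refine orbit_induction ⟨MulAction.mem_orbit_self ξ, .rfl⟩ ?_ ?_
    · rintro η hη ⟨h, hr⟩ s
      exact ⟨smul_mem_orbit _ hη, hr.trans (step _ _ ⟨s, Or.inl rfl⟩)⟩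
    · rintro η hη ⟨h, hr⟩ s
      exact ⟨smul_mem_orbit _ hη, hr.trans (step _ _ ⟨s, Or.inr (smul_inv_smul _ _).symm⟩)⟩
  intro u v
  obtain ⟨_, hu⟩ := key u u.2
  obtain ⟨_, hv⟩ := key v v.2
  exact hu.symm.trans hv

theorem Gamma4_preconnected : Gamma4.toSimpleGraph.Preconnected := by
  obtain ⟨φ⟩ := GraphIso.nonempty_symm nonempty_iso_zeroSeq
  exact φ.preconnected (orbitalSchreier_preconnected zeroSeq)

/-! ### The ends of `Γ_(4)` -/

/-- The coordinate on its line of the point whose decoration contains a vertex. -/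
def Vertex4.abscissa : Vertex4 → ℤ
  | .origin => 0
  | .deco _ n _ => n

theorem abscissa_linePoint (i : Line) (n : ℤ) : (linePoint i n).abscissa = n := by
  by_cases hn : n = 0 <;> simp [linePoint, hn, Vertex4.abscissa]

instance : Finite Line :=
  Finite.of_injective (fun i : Line => i.gen.par) (Gen.par_injective.comp Line.gen_injective)

theorem finite_abscissa_le (N : ℤ) :
    {x : Gamma4.vertexSet | |x.1.abscissa| ≤ N}.Finite := by
  have h : ({Vertex4.origin} ∪ ⋃ i : Line, ⋃ n ∈ Set.Icc (-N) N,
      Vertex4.deco i n '' {w | w.length = height i n}).Finite := by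
    refine (Set.finite_singleton _).union (Set.finite_iUnion fun i => ?_)
    exact (Set.finite_Icc _ _).biUnion fun n _ => (List.finite_length_eq Bool _).image _
  refine Set.Finite.of_finite_image (f := Subtype.val) (h.subset ?_) Subtype.val_injective.injOn
  rintro _ ⟨⟨x, hx⟩, hN, rfl⟩
  rcases x with _ | ⟨i, n, w⟩
  · exact Or.inl rfl
  · refine Or.inr (Set.mem_iUnion.2 ⟨i, Set.mem_iUnion₂.2 ⟨n, abs_le.1 hN, w, ?_, rfl⟩⟩)
    exact hx.2.1

/-- An edge of `Γ_(4)` lies in a decoration or on a line. -/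
theorem Gamma4_adj_cases {u v : Vertex4} (h : Gamma4.Adj u v) :
    (∃ i n w w', n ≠ 0 ∧ u = .deco i n w ∧ v = .deco i n w') ∨
      ∃ i n, s(linePoint i n, linePoint i (n + 1)) = s(u, v) := by
  obtain ⟨⟨i, n⟩ | ⟨i, n, w, s⟩, he, h⟩ := h
  · exact Or.inr ⟨i, n, h⟩
  · refine Or.inl ?_
    rcases Sym2.eq_iff.1 h with ⟨rfl, rfl⟩ | ⟨rfl, rfl⟩
    exacts [⟨i, n, _, _, he.1, rfl, rfl⟩, ⟨i, n, _, _, he.1, rfl, rfl⟩]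

/-- `Γ_(4)` has at most four ends, as the part of it over an interval of the two lines has only four
outer neighbours. -/
theorem card_graphEnd_Gamma4_le : ENat.card (GraphEnd Gamma4) ≤ 4 := by
  classical
  refine card_graphEnd_le_of_boundary (m := 4) Gamma4_preconnected ⟨_, linePoint_mem .one 0⟩ ?_
  intro T hT
  obtain ⟨N, hN⟩ := (hT.image fun x => |x.1.abscissa|).bddAbove
  refine ⟨{x | |x.1.abscissa| ≤ N}, finite_abscissa_le N,
    fun x hx => hN (Set.mem_image_of_mem _ hx),
    {linePoint .one (N + 1), linePoint .one (-(N + 1)), linePoint .two (N + 1),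
      linePoint .two (-(N + 1))}, Finset.card_le_four, ?_⟩
  rintro ⟨u, hu⟩ huN ⟨v, hv⟩ hvN ⟨-, h⟩
  replace huN : |u.abscissa| ≤ N := huN
  replace hvN : ¬ |v.abscissa| ≤ N := hvN
  rw [abs_le] at huN hvN
  have key : ∀ i, v = linePoint i (N + 1) ∨ v = linePoint i (-(N + 1)) →
      v ∈ ({linePoint .one (N + 1), linePoint .one (-(N + 1)), linePoint .two (N + 1),
      linePoint .two (-(N + 1))} : Finset Vertex4) := by
    rintro (_ | _) (h | h) <;> simp [h]
  rcases Gamma4_adj_cases h with ⟨i, n, w, w', -, rfl, rfl⟩ | ⟨i, n, h⟩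
  · exact absurd huN hvN
  · refine key i ?_
    rcases Sym2.eq_iff.1 h with ⟨rfl, rfl⟩ | ⟨rfl, rfl⟩ <;>
      simp only [abscissa_linePoint] at huN hvN
    -- The line leaves the band `|n| ≤ N` only at its points `N + 1` and `-(N + 1)`.
    · right; congr 1; omega
    · left; congr 1; omega

/-- The four half-lines emanating from the common point of the two lines. -/
def halfLine (i : Line) (ε : ℤˣ) : Ray Gamma4 where
  toFun k := ⟨linePoint i (ε * (k + 1)), linePoint_mem _ _⟩
  injective k l h := by
    have h1 := congrArg (fun x : Gamma4.vertexSet => x.1.abscissa) h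
    simp only [abscissa_linePoint] at h1
    rcases Int.units_eq_one_or ε with rfl | rfl <;> simpa using h1
  adj k := by
    rcases Int.units_eq_one_or ε with rfl | rfl
    · exact ⟨.line i (k + 1), trivial, by simp [ends4]⟩
    · refine ⟨.line i (-(k + 1 + 1)), trivial, ?_⟩
      rw [ends4, Sym2.eq_swap]
      push_cast
      congr 3 <;> ring

/-- The half-line carrying the decoration that contains a vertex, given by its line and the sign of
its points. The value at the common point of the two lines is immaterial. -/
def Vertex4.quadrant : Vertex4 → Line × ℤ
  | .origin => (.one, 0)
  | .deco i n _ => (i, n.sign)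

theorem quadrant_linePoint (i : Line) {n : ℤ} (hn : n ≠ 0) :
    (linePoint i n).quadrant = (i, n.sign) := by
  rw [linePoint, if_neg hn]; rfl

theorem quadrant_eq_of_adj {u v : Vertex4} (h : Gamma4.Adj u v) (hu : u ≠ .origin)
    (hv : v ≠ .origin) : u.quadrant = v.quadrant := by
  rcases Gamma4_adj_cases h with ⟨i, n, w, w', -, rfl, rfl⟩ | ⟨i, n, h⟩
  · rfl
  · have h0 : ∀ m, linePoint i m ≠ .origin → m ≠ 0 := by
      rintro _ h rfl
      simp [linePoint] at h
    have key : linePoint i n ≠ .origin → linePoint i (n + 1) ≠ .origin →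
        (linePoint i n).quadrant = (linePoint i (n + 1)).quadrant := by
      intro h1 h2
      have h1 := h0 _ h1
      have h2 := h0 _ h2
      rw [quadrant_linePoint i h1, quadrant_linePoint i h2]
      rcases lt_or_gt_of_ne h1 with h | h
      · rw [Int.sign_eq_neg_one_of_neg h, Int.sign_eq_neg_one_of_neg (by omega)]
      · rw [Int.sign_eq_one_of_pos h, Int.sign_eq_one_of_pos (by omega)]
    rcases Sym2.eq_iff.1 h with ⟨rfl, rfl⟩ | ⟨rfl, rfl⟩
    exacts [key hu hv, (key hv hu).symm]

/-- The four half-lines are separated by the common point of the two lines. -/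
theorem halfLine_injective : Function.Injective fun p : Line × ℤˣ =>
    (Quotient.mk _ (halfLine p.1 p.2) : GraphEnd Gamma4) := by
  rintro ⟨i, ε⟩ ⟨i', ε'⟩ h
  set S : Set Gamma4.vertexSet := {⟨.origin, trivial⟩} with hS
  obtain ⟨C, h1, h2⟩ := Quotient.exact h S (Set.finite_singleton _)
  let q : Gamma4.toSimpleGraph.ComponentCompl S → Line × ℤ :=
    SimpleGraph.ComponentCompl.lift (fun v _ => v.1.quadrant) fun v w hv hw hvw =>
      quadrant_eq_of_adj hvw.2 (fun h => hv (Subtype.ext h)) (fun h => hw (Subtype.ext h))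
  have hq : ∀ x ∈ C, x.1.quadrant = q C := by
    rintro x ⟨hx, rfl⟩
    rfl
  have hl : ∀ i (ε : ℤˣ) k, ((halfLine i ε).toFun k).1.quadrant = (i, (ε : ℤ)) := by
    intro i ε k
    rw [halfLine, quadrant_linePoint i (mul_ne_zero ε.ne_zero (by positivity)), Int.sign_mul,
      Int.sign_eq_one_of_pos (by positivity : (0 : ℤ) < k + 1), mul_one]
    rcases Int.units_eq_one_or ε with rfl | rfl <;> rfl
  obtain ⟨k, hk1, hk2⟩ := (h1.and h2).exists
  have := (hq _ hk1).trans (hq _ hk2).symm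
  rw [hl, hl, Prod.mk.injEq] at this
  exact Prod.ext this.1 (Units.ext this.2)

theorem hasEnds_Gamma4 : HasEnds Gamma4 4 := by
  refine le_antisymm card_graphEnd_Gamma4_le ?_
  have hc : ENat.card (Line × ℤˣ) = 4 := by
    have e : Line ≃ Bool := Equiv.ofBijective (fun i => i.gen.par)
      ⟨Gen.par_injective.comp Line.gen_injective, by
        rintro (_ | _); exacts [⟨.one, rfl⟩, ⟨.two, rfl⟩]⟩
    rw [ENat.card_congr (e.prodCongr (Equiv.refl ℤˣ))]
    simp
  rw [Nat.cast_ofNat, ← hc]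
  exact ENat.card_le_card_of_injective halfLine_injective

/-! ### Orbital Schreier graphs of the other infinite words -/

/-- A generator changes only finitely many letters of an infinite word other than `000⋯`. -/
theorem exists_forall_ge_smul_eq (s : Gen) {η : ℕ → Bool} (hη : η ≠ zeroSeq) :
    ∃ n, ∀ j ≥ n, (s.elt • η) j = η j := by
  obtain ⟨m, hm⟩ := Function.ne_iff.1 hη
  replace hm : η m = true := by simpa [zeroSeq] using hm
  obtain ⟨w, hw, h⟩ := appSeq_prefix (m + 1) η
  have hidle : s.state.after w = .idle := by
    by_contra hne
    have h1 := appSeq_apply_lt w (fun j => η (m + 1 + j)) m (by omega)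
    rw [h, hm, State.eq_zeros_of_after_ne_idle hne, zeros, List.getD_eq_getElem?_getD,
      List.getElem?_replicate] at h1
    split at h1 <;> simp at h1
  refine ⟨m + 1, fun j hj => ?_⟩
  obtain ⟨d, rfl⟩ := Nat.exists_eq_add_of_le hj
  rw [Gen.elt_smul_seq]
  conv_lhs => rw [← h, State.onSeq_appSeq, hidle, State.onSeq_idle, ← hw,
    ← State.length_onWord s.state w, appSeq_apply_add]
  rw [State.length_onWord, hw]

/-- Away from the orbit of `000⋯`, the infinite words of an orbit are cofinal. -/
theorem exists_forall_ge_eq {ξ : ℕ → Bool} (hξ : zeroSeq ∉ MulAction.orbit basilica ξ) :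
    ∀ η ∈ MulAction.orbit basilica ξ, ∃ n, ∀ j ≥ n, η j = ξ j := by
  refine orbit_induction ⟨0, fun _ _ => rfl⟩ ?_ ?_
  · rintro η hη ⟨n, hn⟩ s
    obtain ⟨m, hm⟩ := exists_forall_ge_smul_eq s (η := η) (by rintro rfl; exact hξ hη)
    exact ⟨max n m, fun j hj => (hm j (le_of_max_le_right hj)).trans (hn j (le_of_max_le_left hj))⟩
  · rintro η hη ⟨n, hn⟩ s
    obtain ⟨m, hm⟩ := exists_forall_ge_smul_eq s (η := s.elt⁻¹ • η) (by
      intro h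
      exact hξ (h ▸ smul_mem_orbit _ hη))
    refine ⟨max n m, fun j hj => ?_⟩
    rw [← hm j (le_of_max_le_right hj), smul_inv_smul, hn j (le_of_max_le_left hj)]

theorem State.onSeq_eq_self {s : State} (hs : s ≠ .b) {σ : ℕ → Bool} (hσ : σ 0 = true) :
    s.onSeq σ = σ := by
  conv_lhs => rw [← consSeq_head_tail σ, hσ, State.onSeq_consSeq, State.next_true,
    State.onSeq_idle]
  conv_rhs => rw [← consSeq_head_tail σ, hσ]
  congr 1
  cases s <;> first | rfl | exact absurd rfl hs

/-- If the letter of `ξ` at the position `n` is `1`, the set of the words that agree with `ξ` from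
this position on has at most two outer neighbours. With `σ` the tail of `ξ` from there on, they are
the image of `0 ⋯ 0σ` under the generator whose state after `n` zeros is `b`, and `0 ⋯ 0b⁻¹(σ)`. -/
theorem exists_boundary {ξ : ℕ → Bool} {n : ℕ} (hn : ξ n = true) :
    ∃ B : Finset (ℕ → Bool), B.card ≤ 2 ∧ ∀ u v : ℕ → Bool, (∀ j ≥ n, u j = ξ j) →
      (¬ ∀ j ≥ n, v j = ξ j) → (∃ s : Gen, v = s.elt • u ∨ u = s.elt • v) → v ∈ B := by
  classical
  set σ : ℕ → Bool := fun j => ξ (n + j) with hσ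
  have hσ0 : σ 0 = true := hn
  have hagree : ∀ w : List Bool, w.length = n → ∀ j ≥ n, appSeq w σ j = ξ j := by
    intro w hw j hj
    obtain ⟨d, rfl⟩ := Nat.exists_eq_add_of_le hj
    conv_lhs => rw [← hw]
    rw [appSeq_apply_add]
  obtain ⟨t, ht⟩ : ∃ t : Gen, ∀ s : Gen, s.state.after (zeros n) = .b → s = t := by
    by_cases h : ∃ t : Gen, t.state.after (zeros n) = .b
    · obtain ⟨t, h⟩ := h
      exact ⟨t, fun s hs => Gen.state_injective (State.after_zeros_injective n (hs.trans h.symm))⟩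
    · exact ⟨.a, fun s hs => absurd ⟨s, hs⟩ h⟩
  refine ⟨{t.elt • appSeq (zeros n) σ, appSeq (zeros n) (Gen.b.elt⁻¹ • σ)},
    Finset.card_le_two, ?_⟩
  rintro u v hu hv ⟨s, h | h⟩
  -- Only an edge along which the automaton is in the state `b` after `n` letters can leave the set:
  -- in the states `a` and `idle` it fixes a tail starting with `1`.
  · obtain ⟨w, hw, hwu⟩ := appSeq_prefix n u
    rw [show (fun j => u (n + j)) = σ from funext fun j => hu _ (by omega)] at hwu
    have hb : s.state.after w = .b := by
      by_contra hb
      rw [← hwu, Gen.elt_smul_seq, State.onSeq_appSeq, State.onSeq_eq_self hb hσ0] at h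
      exact hv (h ▸ hagree _ (by rw [State.length_onWord, hw]))
    have hw0 : w = zeros n := hw ▸ State.eq_zeros_of_after_ne_idle (by rw [hb]; simp)
    subst hw0
    rw [h, ← hwu, ht s hb]
    simp
  · obtain ⟨w, hw, hwv⟩ := appSeq_prefix n v
    set τ : ℕ → Bool := fun j => v (n + j)
    obtain ⟨w', hw', hwu⟩ := appSeq_prefix n u
    rw [show (fun j => u (n + j)) = σ from funext fun j => hu _ (by omega)] at hwu
    rw [← hwu, ← hwv, Gen.elt_smul_seq, State.onSeq_appSeq] at h
    obtain ⟨-, h⟩ := appSeq_inj (by rw [State.length_onWord, hw, hw']) h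
    have hb : s.state.after w = .b := by
      by_contra hb
      have hτ0 : τ 0 = true := by
        have h0 : σ 0 = (s.state.after w).out (τ 0) := congrFun h 0
        rw [hσ0] at h0
        revert h0 hb
        cases s.state.after w <;> simp [State.out]
      rw [State.onSeq_eq_self hb hτ0] at h
      exact hv (by rw [← hwv, ← h]; exact hagree _ hw)
    have hw0 : w = zeros n := hw ▸ State.eq_zeros_of_after_ne_idle (by rw [hb]; simp)
    have hτ : τ = Gen.b.elt⁻¹ • σ := by
      rw [eq_inv_smul_iff, h, hb]
      rfl
    rw [← hwv, hw0, hτ]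
    simp

/-- An orbital Schreier graph outside the orbit of `000⋯` has at most two ends. -/
theorem card_graphEnd_orbitalSchreier_le {ξ : ℕ → Bool}
    (h0 : zeroSeq ∉ MulAction.orbit basilica ξ) (h1 : ∃ᶠ n in atTop, ξ n = true) :
    ENat.card (GraphEnd (orbitalSchreier ξ)) ≤ 2 := by
  refine card_graphEnd_le_of_boundary (m := 2) (orbitalSchreier_preconnected ξ)
    ⟨ξ, MulAction.mem_orbit_self ξ⟩ ?_
  intro T hT
  choose N hN using fun x : (orbitalSchreier ξ).vertexSet => exists_forall_ge_eq h0 x.1 x.2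
  obtain ⟨M, hM⟩ := (hT.image N).bddAbove
  obtain ⟨n, hnM, hn⟩ := frequently_atTop.1 h1 M
  obtain ⟨B, hB, hbound⟩ := exists_boundary hn
  refine ⟨{x | ∀ j ≥ n, x.1 j = ξ j}, ?_, ?_, B, hB, ?_⟩
  · refine Set.Finite.of_finite_image (f := Subtype.val) (((List.finite_length_eq Bool n).image
      fun w => appSeq w fun j => ξ (n + j)).subset ?_) Subtype.val_injective.injOn
    rintro _ ⟨x, hx, rfl⟩
    obtain ⟨w, hw, h⟩ := appSeq_prefix n x.1
    refine ⟨w, hw, ?_⟩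
    show appSeq w (fun j => ξ (n + j)) = x.1
    rw [show (fun j => ξ (n + j)) = fun j => x.1 (n + j) from
      funext fun j => (hx (n + j) (by omega)).symm]
    exact h
  · intro x hx j hj
    exact hN x j (((hM (Set.mem_image_of_mem _ hx)).trans hnM).trans hj)
  · intro u hu v hv h
    obtain ⟨-, s, h⟩ := orbitalSchreier_adj.1 h
    exact hbound u.1 v.1 hu hv ⟨s, h.symm⟩

/-- An infinite word whose orbital Schreier graph has four ends is in the orbit of `000⋯`: otherwise
it contains infinitely many letters `1`, since words that are eventually `0` are in that orbit. -/
theorem zeroSeq_mem_orbit_of_mem_E4 {ξ : ℕ → Bool} (hξ : ξ ∈ E4) :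
    zeroSeq ∈ MulAction.orbit basilica ξ := by
  by_contra h0
  by_cases h1 : ∃ᶠ n in atTop, ξ n = true
  · have h2 := card_graphEnd_orbitalSchreier_le h0 h1
    have h4 : ENat.card (GraphEnd (orbitalSchreier ξ)) = (4 : ℕ) := hξ
    rw [h4] at h2
    exact absurd h2 (by norm_num)
  · obtain ⟨n, hn⟩ := eventually_atTop.1 (not_frequently.1 h1)
    have hz : (fun j => ξ (n + j)) = zeroSeq :=
      funext fun j => by simpa [zeroSeq] using hn (n + j) (by omega)
    obtain ⟨w, -, h⟩ := appSeq_prefix n ξ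
    have h2 := appSeq_mem_orbit w zeroSeq
    rw [appSeq_zeros_zeroSeq, ← hz, h, hz] at h2
    exact h0 (MulAction.mem_orbit_symm.1 h2)

end Basilica

theorem mainTheorem5 :
    Basilica.HasEnds Basilica.Gamma4 4 ∧
      ∀ ξ ∈ Basilica.E4,
        Nonempty (Basilica.GraphIso (Basilica.orbitalSchreier ξ) Basilica.Gamma4) := by
  refine ⟨Basilica.hasEnds_Gamma4, fun ξ hξ => ?_⟩
  have h : Basilica.orbitalSchreier ξ = Basilica.orbitalSchreier Basilica.zeroSeq := by
    rw [Basilica.orbitalSchreier,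
      ← MulAction.orbit_eq_iff.2 (Basilica.zeroSeq_mem_orbit_of_mem_E4 hξ)]
    rfl
  rw [h]
  exact Basilica.GraphIso.nonempty_symm Basilica.nonempty_iso_zeroSeq
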